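/- Let $K$ be a field, let $t\ge 2$, $k\ge 3$, $1\le d\le t$ be integers, $n=d+kt$ and $S=K[x_1,\dots,x_n]$. \emph{Definitions.} A monomial $x_{i_1}x_{i_2}\cdots x_{i_m}$ with $i_1\le\dots\le i_m$ is $t$-spread if $i_{j+1}-i_j\ge t$ for all $j$. A $t$-spread strongly stable ideal is an ideal $I$ of $S$ generated by $t$-spread monomials such that, for every $t$-spread monomial $u\in I$, every $j$ with $x_j\mid u$ and every $i<j$ such that $x_i(u/x_j)$ is $t$-spread, one has $x_i(u/x_j)\in I$. For $t$-spread monomials $u_0,\dots,u_r$, $B_t(u_0,\dots,u_r)$ denotes the smallest $t$-spread strongly stable ideal containing them. The initial degree of $I\neq 0$ is the least degree of a nonzero homogeneous element of $I$. With $\beta_{i,j}(I)=\dim_K \mathrm{Tor}_i^S(K,I)_j$, a graded Betti number $\beta_{a,a+\ell}(I)\ne0$ is extremal, and $(a,\ell)$ is a corner of $I$ (in degree $\ell$), if $\beta_{i,i+j}(I)=0$ for all $i\ge a$, $j\ge \ell$ with $(i,j)\ne(a,\ell)$. \emph{Basic monomials.} Put $j_{\max}=\lfloor \frac{n}{t+1}\rfloor-1$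 and $s=2t-\big[n-(j_{\max}+1)-j_{\max}t\big]\ge 0$. For $0\le j\le j_{\max}$ let (forward monomials) $$\omega_j=\Big(\prod_{i=0}^{j-1}x_{2+i+it}\Big)\,x_{(j+1)+jt}\,x_n ,\qquad\text{so that } \omega_0=x_1x_n,$$ and for $j=j_{\max}+1+\nu$ with $\nu\ge 0$ and $j\le k+\lfloor\frac{d-3}{t}\rfloor-1$ let (backward monomials) $$\omega_j=\Big(\prod_{i=0}^{p-1}x_{2+i+it}\Big)\Big(\prod_{i=q}^{k}x_{d+it}\Big),\qquad p=j_{\max}-2-s-\nu t,\quad q=k-4-s-\nu(1+t),$$ where $p,q\ge 0$ for these $\nu$ (and there may be no such $\nu$). \emph{Theorem.} (1) Every $t$-spread strongly stable ideal $I$ of $S$ of initial degree $2$, all of whose extremal Betti numbers are equal to $1$, and having a corner in degree $2$, has at most $$k+\Big\lfloor\frac{d-3}{t}\Big\rfloor$$ corners. (2) This number is equal to $k-1$ if $d\in\{1,2\}$, and to $k$ if $3\le d\le t$. (3) The bound is attained: with $r=k+\lfloor\frac{d-3}{t}\rfloor-1$, the ideal $B_t(\omega_0,\omega_1,\dots,\omega_r)$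 is a $t$-spread strongly stable ideal of initial degree $2$, all its extremal Betti numbers are equal to $1$, it has a corner in degree $2$, and it has exactly $k+\lfloor\frac{d-3}{t}\rfloor$ corners. -/

import Mathlib

open MvPolynomial

noncomputable section

namespace TSpread

/-! ### Monomials and ideals

The polynomial ring is `MvPolynomial (Fin n) K`; the variable written `x_i` (`1 ≤ i ≤ n`) in
ordinary notation is `X` at the element of `Fin n` with value `i - 1`.  A monomial is given by
its exponent vector `u : Fin n →₀ ℕ`. -/

variable {K : Type*} [Field K] {n : ℕ}

/-- The monomial `x^u` is `t`-spread: writing it as `x_{i_1} ⋯ x_{i_d}` with `i_1 ≤ ⋯ ≤ i_d`, one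
has `i_{j+1} - i_j ≥ t` for all `j`.  (The first clause deals with repeated indices, the second
with distinct ones.) -/
def IsSpread (t : ℕ) (u : Fin n →₀ ℕ) : Prop :=
  (∀ i, 2 ≤ u i → t = 0) ∧ ∀ i j, u i ≠ 0 → u j ≠ 0 → i < j → (i : ℕ) + t ≤ (j : ℕ)

/-- A `t`-spread monomial ideal: an ideal generated by `t`-spread monomials. -/
def IsSpreadIdeal (t : ℕ) (I : Ideal (MvPolynomial (Fin n) K)) : Prop :=
  ∃ A : Set (Fin n →₀ ℕ), (∀ u ∈ A, IsSpread t u) ∧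
    I = Ideal.span ((fun u => monomial u (1 : K)) '' A)

/-- A `t`-spread strongly stable ideal: a `t`-spread monomial ideal such that for all `t`-spread
monomials `u ∈ I`, all `j ∈ supp u` and all `i < j` such that `x_i (u / x_j)` is `t`-spread,
one has `x_i (u / x_j) ∈ I`. -/
def IsStronglyStable (t : ℕ) (I : Ideal (MvPolynomial (Fin n) K)) : Prop :=
  IsSpreadIdeal t I ∧
    ∀ u : Fin n →₀ ℕ, IsSpread t u → monomial u (1 : K) ∈ I →
      ∀ j, u j ≠ 0 → ∀ i, i < j →
        IsSpread t (u - Finsupp.single j 1 + Finsupp.single i 1) →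
          monomial (u - Finsupp.single j 1 + Finsupp.single i 1) (1 : K) ∈ I

/-- `B_t(G)`: the smallest `t`-spread strongly stable ideal containing the monomials in `G`,
as the intersection of all such ideals. -/
def borelIdeal (K : Type*) [Field K] (t : ℕ) (G : Set (Fin n →₀ ℕ)) :
    Ideal (MvPolynomial (Fin n) K) :=
  sInf {I | IsStronglyStable t I ∧ ∀ u ∈ G, monomial u (1 : K) ∈ I}

/-- `indeg I = m`: `m` is the least degree of a nonzero homogeneous element of `I`. -/
def HasInitialDegree (I : Ideal (MvPolynomial (Fin n) K)) (m : ℕ) : Prop :=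
  IsLeast {j : ℕ | ∃ f ∈ I, f ≠ 0 ∧ f.IsHomogeneous j} m

/-! ### Graded Betti numbers

`β_{i,j}(I) = dim_K Tor_i^S(K, I)_j`, where the Tor modules are computed by the Koszul complex of
`x_1, …, x_n` (the minimal graded free resolution of `K`) tensored with `I`. A Koszul chain
`∑_T f_T e_T`, with `T` running over the subsets of the set of variables, is stored as the family
of its coefficients. -/

/-- The Koszul differential `e_T ↦ ∑_{a ∈ T} (-1)^{#{b ∈ T, b < a}} x_a e_{T \ {a}}`, on
coefficients. -/
def koszulDiff (K : Type*) [Field K] (n : ℕ) :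
    (Finset (Fin n) → MvPolynomial (Fin n) K) →ₗ[K]
      (Finset (Fin n) → MvPolynomial (Fin n) K) where
  toFun f := fun T => ∑ a ∈ Tᶜ, (-1) ^ (T.filter (· < a)).card * X a * f (insert a T)
  map_add' f g := by
    funext T
    simp [mul_add, Finset.sum_add_distrib]
  map_smul' c f := by
    funext T
    simp [Finset.smul_sum]

/-- Koszul chains of homological degree `i` and internal degree `j` with coefficients in `I`:
only sets `T` with `i` elements occur, and `f_T` is a homogeneous element of `I` of degree
`j - i` (zero if `j < i`). -/
def koszulChains (I : Ideal (MvPolynomial (Fin n) K)) (i j : ℕ) :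
    Submodule K (Finset (Fin n) → MvPolynomial (Fin n) K) where
  carrier := {f | ∀ T, f T ∈ I ∧ ∀ m ∈ (f T).support, T.card = i ∧ m.degree + i = j}
  zero_mem' := by
    intro T
    simp
  add_mem' := by
    classical
    intro f g hf hg T
    refine ⟨I.add_mem (hf T).1 (hg T).1, fun m hm => ?_⟩
    rcases Finset.mem_union.1 (MvPolynomial.support_add hm) with h | h
    · exact (hf T).2 m h
    · exact (hg T).2 m h
  smul_mem' := by
    intro c f hf T
    refine ⟨?_, fun m hm => (hf T).2 m (MvPolynomial.support_smul hm)⟩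
    simpa [MvPolynomial.smul_eq_C_mul] using I.mul_mem_left (C c) (hf T).1

/-- Koszul cycles of homological degree `i` and internal degree `j`. -/
def koszulCycles (I : Ideal (MvPolynomial (Fin n) K)) (i j : ℕ) :
    Submodule K (Finset (Fin n) → MvPolynomial (Fin n) K) :=
  koszulChains I i j ⊓ LinearMap.ker (koszulDiff K n)

/-- Koszul boundaries of homological degree `i` and internal degree `j`. -/
def koszulBoundaries (I : Ideal (MvPolynomial (Fin n) K)) (i j : ℕ) :
    Submodule K (Finset (Fin n) → MvPolynomial (Fin n) K) :=
  (koszulChains I (i + 1) j).map (koszulDiff K n)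

/-- The graded Betti number `β_{i,j}(I)` (`j` is the total internal degree). -/
def betti (I : Ideal (MvPolynomial (Fin n) K)) (i j : ℕ) : ℕ :=
  Module.finrank K
    (↥(koszulCycles I i j) ⧸ (koszulBoundaries I i j).submoduleOf (koszulCycles I i j))

/-- `(a, l)` is a corner of `I`, i.e. `β_{a,a+l}(I)` is an extremal Betti number. -/
def IsCorner (I : Ideal (MvPolynomial (Fin n) K)) (a l : ℕ) : Prop :=
  betti I a (a + l) ≠ 0 ∧
    ∀ i j : ℕ, a ≤ i → l ≤ j → (i, j) ≠ (a, l) → betti I i (i + j) = 0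

/-- The set `Corn(I)` of corners of `I`. -/
def corners (I : Ideal (MvPolynomial (Fin n) K)) : Set (ℕ × ℕ) :=
  {p | IsCorner I p.1 p.2}

/-- `I` is a `t`-spread strongly stable ideal all of whose extremal Betti numbers equal `1`. -/
def IsStronglyStableOne (t : ℕ) (I : Ideal (MvPolynomial (Fin n) K)) : Prop :=
  IsStronglyStable t I ∧ ∀ a l : ℕ, IsCorner I a l → betti I a (a + l) = 1

/-! ### Basic monomials -/

/-- Exponent vector of the squarefree monomial `∏_{i ∈ A} x_i` of `K[x_1, …, x_n]`, for a set
`A ⊆ {1, …, n}` of (one-based) indices. -/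
def sqfree (n : ℕ) (A : Finset ℕ) : Fin n →₀ ℕ :=
  Finsupp.equivFunOnFinite.symm fun i => if (i : ℕ) + 1 ∈ A then 1 else 0

/-- `j_max = ⌊n / (t + 1)⌋ - 1`. -/
def jMax (n t : ℕ) : ℕ := n / (t + 1) - 1

/-- `s = 2t - (n - ((j_max + 1) + j_max t))`, a nonnegative integer since
`n - ((j_max + 1) + j_max t) ≤ 2t`. -/
def sNum (n t : ℕ) : ℕ := 2 * t - (n - ((jMax n t + 1) + jMax n t * t))

/-- Indices of the variables of the forward monomial
`(∏_{i=0}^{j-1} x_{2+i+it}) x_{(j+1)+jt} x_n`; for `j = 0` this is `x_1 x_n`. -/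
def forwardSet (n t j : ℕ) : Finset ℕ :=
  (Finset.range j).image (fun i => 2 + i + i * t) ∪ {(j + 1) + j * t, n}

/-- Indices of the variables of the backward monomial
`(∏_{i=0}^{p-1} x_{2+i+it}) (∏_{i=q}^{k} x_{d+it})`, with `p = j_max - 2 - s - νt` and
`q = k - 4 - s - ν(1+t)`, where `n = d + kt`. -/
def backwardSet (t k d ν : ℕ) : Finset ℕ :=
  (Finset.range (jMax (d + k * t) t - 2 - sNum (d + k * t) t - ν * t)).image
      (fun i => 2 + i + i * t) ∪
    (Finset.Icc (k - 4 - sNum (d + k * t) t - ν * (1 + t)) k).image (fun i => d + i * t)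

/-- The basic monomials of `K[x_1, …, x_n]`, `n = d + kt`: `ω_j` is a forward monomial for
`j ≤ j_max`, and the backward monomial with `ν = j - j_max - 1` for `j > j_max`. -/
def basicMonomial (t k d j : ℕ) : Fin (d + k * t) →₀ ℕ :=
  if j ≤ jMax (d + k * t) t then sqfree (d + k * t) (forwardSet (d + k * t) t j)
  else sqfree (d + k * t) (backwardSet t k d (j - jMax (d + k * t) t - 1))

/-- The ideal `B_t(ω_0, …, ω_r)`, `r = k + ⌊(d - 3) / t⌋ - 1`. -/
def basicIdeal (K : Type*) [Field K] (t k d : ℕ) : Ideal (MvPolynomial (Fin (d + k * t)) K) :=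
  borelIdeal K t {u | ∃ j : ℕ, (j : ℤ) ≤ k + ⌊((d : ℚ) - 3) / t⌋ - 1 ∧ u = basicMonomial t k d j}

end TSpread

end

noncomputable section

namespace TSpread

variable {K : Type*} [Field K] {n : ℕ}

/-! ### Koszul chains of monomial ideals -/

/-! The argument turns Betti numbers into combinatorics of index sequences.

A monomial ideal is built up one generator at a time. If the colon ideal of the earlier generators
by `x^u` is generated by the variables in `A`, then modulo the smaller ideal the new Koszul chains
are those of `x^u · S/(x_a : a ∈ A)`, whose homology is an exterior algebra on `A`. Generators are
added in order of degree, so the connecting map vanishes and each one contributes `(A.card).choose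
i` in bidegree `(i, deg u + i)` (`IsHomologyBasis.add_generator`, `betti_monomialIdeal_eq_sum`).

For a `t`-spread strongly stable ideal, membership of spread monomials is closed under termwise
lowering of sorted index sequences (`IsStronglyStable.hasMonomial_of_dom`). Hence the minimal
generators, taken by degree and then from dominance-low to dominance-high, have linear colon ideals
given by `gapSet` (`IsStronglyStable.isLinearColon`). In degree `l` the size of `gapSet` is the
largest one-based index minus `t(l-1)+1`, so corners are read off from the largest index in each
degree (`IsStronglyStable.isCorner_iff`).

Upper bound: there is at most one corner per degree, and degrees range over `2, …, k+1`, giving `k`.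
If `d ≤ 2`, a generator of degree `k+1` is squeezed so tightly to the left that corners in degrees
2, 3 and `k+1` cannot coexist (`IsStronglyStable.not_isCorner_three_and_last`), so one degree is
lost.

Sharpness: every `ω_j` has degree `j+2` and involves `x_n`, so it has the largest `gapSet` possible
in its degree. No `ω_j` lies below an earlier one (`not_dom_basicSupport`), which makes all of them
minimal generators and gives a corner in each degree. `eq_basicSupport` shows that no other minimal
generator of that degree involves `x_n`, so the extremal Betti numbers are 1. -/

/-- The Koszul sign `(-1)^{#{b ∈ T, b < a}}`. -/
def koszulSign (R : Type*) [CommRing R] (T : Finset (Fin n)) (a : Fin n) : R :=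
  (-1) ^ (T.filter (· < a)).card

lemma koszulSign_insert {R : Type*} [CommRing R] {T : Finset (Fin n)} {a : Fin n} (ha : a ∉ T)
    (b : Fin n) :
    koszulSign R (insert a T) b = (if a < b then -1 else 1) * koszulSign R T b := by
  unfold koszulSign
  rw [Finset.filter_insert]
  split_ifs with h
  · rw [Finset.card_insert_of_notMem (by simp [ha]), pow_succ]
    ring
  · simp

lemma koszulSign_mul_self {R : Type*} [CommRing R] (T : Finset (Fin n)) (a : Fin n) :
    koszulSign R T a * koszulSign R T a = 1 := by
  unfold koszulSign
  rw [← mul_pow]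
  simp

/-- Exactly one of the two insertions changes the number of smaller elements seen by the other
index. This is the sign cancellation behind `d² = 0` and behind the homotopy below. -/
lemma koszulSign_swap {R : Type*} [CommRing R] {T : Finset (Fin n)} {a b : Fin n} (ha : a ∉ T)
    (hb : b ∉ T) (hab : a ≠ b) :
    koszulSign R T a * koszulSign R (insert a T) b
      = - (koszulSign R T b * koszulSign R (insert b T) a) := by
  rw [koszulSign_insert ha, koszulSign_insert hb]
  rcases lt_or_gt_of_ne hab with h | h
  · rw [if_pos h, if_neg h.not_gt]
    ring
  · rw [if_neg h.not_gt, if_pos h]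
    ring

lemma koszulDiff_apply (f : Finset (Fin n) → MvPolynomial (Fin n) K) (T : Finset (Fin n)) :
    koszulDiff K n f T
      = ∑ a ∈ Tᶜ, koszulSign (MvPolynomial (Fin n) K) T a * X a * f (insert a T) := rfl

lemma koszulDiff_koszulDiff (f : Finset (Fin n) → MvPolynomial (Fin n) K) :
    koszulDiff K n (koszulDiff K n f) = 0 := by
  funext T
  simp only [koszulDiff_apply, Finset.mul_sum, Pi.zero_apply]
  rw [Finset.sum_sigma']
  refine Finset.sum_involution (fun p _ => ⟨p.2, p.1⟩) ?_ ?_ ?_ ?_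
  · rintro ⟨a, b⟩ h
    simp only [Finset.mem_sigma, Finset.mem_compl, Finset.mem_insert, not_or] at h
    have := koszulSign_swap (R := MvPolynomial (Fin n) K) h.1 h.2.2 (Ne.symm h.2.1)
    simp only [Finset.insert_comm b a]
    linear_combination (X a * X b * f (insert a (insert b T))) * this
  · rintro ⟨a, b⟩ h _ he
    simp only [Finset.mem_sigma, Finset.mem_compl, Finset.mem_insert, not_or] at h
    simp only [Sigma.mk.injEq, heq_eq_eq] at he
    exact h.2.1 he.1
  · rintro ⟨a, b⟩ h
    simp only [Finset.mem_sigma, Finset.mem_compl, Finset.mem_insert, not_or] at h ⊢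
    exact ⟨h.2.2, Ne.symm h.2.1, h.1⟩
  · rintro ⟨a, b⟩ h
    rfl

lemma coeff_koszulDiff (f : Finset (Fin n) → MvPolynomial (Fin n) K) (T : Finset (Fin n))
    (m : Fin n →₀ ℕ) :
    coeff m (koszulDiff K n f T) = ∑ a ∈ Tᶜ, if m a = 0 then 0 else
      koszulSign K T a * coeff (m - Finsupp.single a 1) (f (insert a T)) := by
  rw [koszulDiff_apply, coeff_sum]
  refine Finset.sum_congr rfl fun a _ => ?_
  have : koszulSign (MvPolynomial (Fin n) K) T a = C (koszulSign K T a) := by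
    simp [koszulSign]
  rw [this, mul_assoc, coeff_C_mul, coeff_X_mul']
  by_cases h : m a = 0 <;> simp [h]

/-- The ideal spanned by the monomials with exponents in `s`. -/
def monomialIdeal (K : Type*) [Field K] (s : Set (Fin n →₀ ℕ)) : Ideal (MvPolynomial (Fin n) K) :=
  Ideal.span ((fun u => monomial u (1 : K)) '' s)

lemma mem_monomialIdeal {s : Set (Fin n →₀ ℕ)} {f : MvPolynomial (Fin n) K} :
    f ∈ monomialIdeal K s ↔ ∀ m, coeff m f ≠ 0 → ∃ v ∈ s, v ≤ m := by
  rw [monomialIdeal, mem_ideal_span_monomial_image]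
  simp [mem_support_iff]

lemma monomial_mem_monomialIdeal {s : Set (Fin n →₀ ℕ)} {m : Fin n →₀ ℕ} :
    monomial m (1 : K) ∈ monomialIdeal K s ↔ ∃ v ∈ s, v ≤ m := by
  classical
  rw [mem_monomialIdeal]
  constructor
  · intro h
    exact h m (by simp)
  · intro h m' hm'
    rw [coeff_monomial] at hm'
    have : m = m' := by
      by_contra hne
      simp [hne] at hm'
    rwa [← this]

lemma mem_koszulChains {s : Set (Fin n →₀ ℕ)} {i d : ℕ}
    {f : Finset (Fin n) → MvPolynomial (Fin n) K} :
    f ∈ koszulChains (monomialIdeal K s) i d ↔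
      ∀ T m, coeff m (f T) ≠ 0 → (∃ v ∈ s, v ≤ m) ∧ T.card = i ∧ m.degree + i = d := by
  change (∀ T, f T ∈ monomialIdeal K s ∧ ∀ m ∈ (f T).support, T.card = i ∧ m.degree + i = d) ↔ _
  simp only [mem_monomialIdeal, mem_support_iff]
  exact forall_congr' fun T => ⟨fun h m hm => ⟨h.1 m hm, h.2 m hm⟩,
    fun h => ⟨fun m hm => (h m hm).1, fun m hm => (h m hm).2⟩⟩

lemma coeff_eq_zero_of_mem_koszulChains {s : Set (Fin n →₀ ℕ)} {i d : ℕ}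
    {f : Finset (Fin n) → MvPolynomial (Fin n) K} (hf : f ∈ koszulChains (monomialIdeal K s) i d)
    {m : Fin n →₀ ℕ} (hm : ¬ ∃ v ∈ s, v ≤ m) (T : Finset (Fin n)) : coeff m (f T) = 0 := by
  by_contra h
  exact hm (mem_koszulChains.1 hf T m h).1

lemma koszulDiff_mem_koszulChains {s : Set (Fin n →₀ ℕ)} {i d : ℕ}
    {f : Finset (Fin n) → MvPolynomial (Fin n) K}
    (hf : f ∈ koszulChains (monomialIdeal K s) (i + 1) d) :
    koszulDiff K n f ∈ koszulChains (monomialIdeal K s) i d := by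
  rw [mem_koszulChains] at hf ⊢
  intro T m hm
  rw [coeff_koszulDiff] at hm
  obtain ⟨a, ha, hne⟩ := Finset.exists_ne_zero_of_sum_ne_zero hm
  have hma : m a ≠ 0 := by
    intro h0
    simp [h0] at hne
  rw [if_neg hma] at hne
  obtain ⟨⟨v, hv, hvm⟩, hc, hd⟩ := hf _ _ (right_ne_zero_of_mul hne)
  have hle : Finsupp.single a 1 ≤ m := by
    simpa [Finsupp.single_le_iff] using Nat.one_le_iff_ne_zero.2 hma
  have hdeg : (m - Finsupp.single a 1).degree + 1 = m.degree := by
    conv_rhs => rw [← tsub_add_cancel_of_le hle]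
    simp
  refine ⟨⟨v, hv, hvm.trans tsub_le_self⟩, ?_, by omega⟩
  rw [Finset.card_insert_of_notMem (by simpa using ha)] at hc
  omega

lemma koszulDiff_eq_zero_of_mem_koszulChains_zero {s : Set (Fin n →₀ ℕ)} {d : ℕ}
    {f : Finset (Fin n) → MvPolynomial (Fin n) K}
    (hf : f ∈ koszulChains (monomialIdeal K s) 0 d) : koszulDiff K n f = 0 := by
  funext T
  rw [koszulDiff_apply]
  refine Finset.sum_eq_zero fun a _ => ?_
  have : f (insert a T) = 0 := by
    ext m
    by_contra h
    have := (mem_koszulChains.1 hf _ m h).2.1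
    simp at this
  simp [this]

lemma koszulChains_mono {s s' : Set (Fin n →₀ ℕ)} (h : s ⊆ s') (i d : ℕ) :
    koszulChains (monomialIdeal K s) i d ≤ koszulChains (monomialIdeal K s') i d := by
  intro f hf
  rw [mem_koszulChains] at hf ⊢
  intro T m hm
  obtain ⟨⟨v, hv, hvm⟩, h2⟩ := hf T m hm
  exact ⟨⟨v, h hv, hvm⟩, h2⟩

/-- A family of cycles whose classes form a basis of the Koszul homology in bidegree `(i, d)`. -/
structure IsHomologyBasis (I : Ideal (MvPolynomial (Fin n) K)) (i d : ℕ) {ι : Type*} [Fintype ι]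
    (z : ι → Finset (Fin n) → MvPolynomial (Fin n) K) : Prop where
  mem : ∀ j, z j ∈ koszulCycles I i d
  span : ∀ c ∈ koszulCycles I i d, ∃ a : ι → K, c - ∑ j, a j • z j ∈ koszulBoundaries I i d
  indep : ∀ a : ι → K, ∑ j, a j • z j ∈ koszulBoundaries I i d → ∀ j, a j = 0

lemma IsHomologyBasis.betti_eq {I : Ideal (MvPolynomial (Fin n) K)} {i d : ℕ} {ι : Type*}
    [Fintype ι] {z : ι → Finset (Fin n) → MvPolynomial (Fin n) K} (h : IsHomologyBasis I i d z) :
    betti I i d = Fintype.card ι := by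
  let B := (koszulBoundaries I i d).submoduleOf (koszulCycles I i d)
  let v : ι → ↥(koszulCycles I i d) ⧸ B := fun j => B.mkQ ⟨z j, h.mem j⟩
  have hsum : ∀ a : ι → K, ∑ j, a j • v j
      = B.mkQ (∑ j, a j • (⟨z j, h.mem j⟩ : koszulCycles I i d)) := by
    intro a
    simp only [v, map_sum, map_smul]
  have hli : LinearIndependent K v := by
    rw [Fintype.linearIndependent_iff]
    intro a ha
    rw [hsum, Submodule.mkQ_apply, Submodule.Quotient.mk_eq_zero] at ha
    refine h.indep a ?_
    simpa [B, Submodule.submoduleOf] using ha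
  have hsp : ⊤ ≤ Submodule.span K (Set.range v) := by
    rintro x -
    obtain ⟨⟨c, hc⟩, rfl⟩ := B.mkQ_surjective x
    obtain ⟨a, ha⟩ := h.span c hc
    have : B.mkQ ⟨c, hc⟩ = ∑ j, a j • v j := by
      rw [hsum, Submodule.mkQ_apply, Submodule.mkQ_apply, Submodule.Quotient.eq]
      simpa [B, Submodule.submoduleOf] using ha
    rw [this]
    exact Submodule.sum_mem _ fun j _ => Submodule.smul_mem _ _ (Submodule.subset_span ⟨j, rfl⟩)
  exact Module.finrank_eq_card_basis (Module.Basis.mk hli hsp)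

lemma mem_koszulBoundaries {I : Ideal (MvPolynomial (Fin n) K)} {i d : ℕ}
    {f : Finset (Fin n) → MvPolynomial (Fin n) K} :
    f ∈ koszulBoundaries I i d ↔ ∃ y ∈ koszulChains I (i + 1) d, koszulDiff K n y = f :=
  Submodule.mem_map

lemma mem_koszulCycles {I : Ideal (MvPolynomial (Fin n) K)} {i d : ℕ}
    {f : Finset (Fin n) → MvPolynomial (Fin n) K} :
    f ∈ koszulCycles I i d ↔ f ∈ koszulChains I i d ∧ koszulDiff K n f = 0 := by
  simp [koszulCycles]

lemma exists_coeff_eq (F : Finset (Fin n) → (Fin n →₀ ℕ) → K) (hF : ∀ T, (F T).support.Finite) :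
    ∃ f : Finset (Fin n) → MvPolynomial (Fin n) K, ∀ T m, coeff m (f T) = F T m := by
  refine ⟨fun T => ∑ m ∈ (hF T).toFinset, monomial m (F T m), fun T m => ?_⟩
  simp only [coeff_sum, coeff_monomial]
  rw [Finset.sum_ite_eq']
  by_cases h : F T m = 0 <;> simp [h]

/-! ### Adding a generator with a linear colon ideal -/

/-- The colon ideal of the monomial ideal spanned by `s` with respect to `x^u` is generated by
the variables with index in `A`. -/
def IsLinearColon (s : Set (Fin n →₀ ℕ)) (u : Fin n →₀ ℕ) (A : Finset (Fin n)) : Prop :=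
  ∀ w : Fin n →₀ ℕ, (∃ v ∈ s, v ≤ u + w) ↔ ∃ i ∈ A, w i ≠ 0

/-- `a` is the largest index occurring in `T \ A` or in the monomial `x^w`. -/
def IsTopIndex (A T : Finset (Fin n)) (w : Fin n →₀ ℕ) (a : Fin n) : Prop :=
  (a ∈ T \ A ∨ w a ≠ 0) ∧ ∀ b, (b ∈ T \ A ∨ w b ≠ 0) → b ≤ a

lemma IsTopIndex.unique {A T : Finset (Fin n)} {w : Fin n →₀ ℕ} {a b : Fin n}
    (ha : IsTopIndex A T w a) (hb : IsTopIndex A T w b) : a = b :=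
  le_antisymm (hb.2 _ ha.1) (ha.2 _ hb.1)

lemma exists_isTopIndex {A T : Finset (Fin n)} {w : Fin n →₀ ℕ} (h : ¬ (T ⊆ A ∧ w = 0)) :
    ∃ a, IsTopIndex A T w a := by
  classical
  let P : Finset (Fin n) := Finset.univ.filter fun a => a ∈ T \ A ∨ w a ≠ 0
  have hP : P.Nonempty := by
    by_contra hne
    rw [Finset.not_nonempty_iff_eq_empty, Finset.filter_eq_empty_iff] at hne
    refine h ⟨fun a ha => ?_, ?_⟩
    · by_contra hA
      exact hne (Finset.mem_univ a) (Or.inl (Finset.mem_sdiff.2 ⟨ha, hA⟩))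
    · ext a
      by_contra hA
      exact hne (Finset.mem_univ a) (Or.inr hA)
  refine ⟨P.max' hP, ?_, fun b hb => P.le_max' b ?_⟩
  · simpa [P] using P.max'_mem hP
  · simpa [P] using hb

/-- Exponents `u + w` with `w` vanishing on `A` index the quotient of the two chain complexes. There
the differential only lowers `w`: dividing by a variable that `w` does not contain leaves the larger
ideal. -/
lemma coeff_koszulDiff_add {s : Set (Fin n →₀ ℕ)} {u : Fin n →₀ ℕ} {A : Finset (Fin n)}
    (hcol : IsLinearColon s u A) {i d : ℕ} {f : Finset (Fin n) → MvPolynomial (Fin n) K}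
    (hf : f ∈ koszulChains (monomialIdeal K (insert u s)) i d) (T : Finset (Fin n))
    {w : Fin n →₀ ℕ} (hw : ∀ b ∈ A, w b = 0) :
    coeff (u + w) (koszulDiff K n f T) = ∑ b ∈ Tᶜ, if w b = 0 then 0 else
      koszulSign K T b * coeff (u + (w - Finsupp.single b 1)) (f (insert b T)) := by
  rw [coeff_koszulDiff]
  refine Finset.sum_congr rfl fun b _ => ?_
  by_cases hwb : w b = 0
  · rw [if_pos hwb]
    by_cases hub : (u + w) b = 0
    · rw [if_pos hub]
    · rw [if_neg hub, coeff_eq_zero_of_mem_koszulChains hf, mul_zero]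
      rintro ⟨v, hv, hle⟩
      rcases hv with rfl | hv
      · have h1 := hle b
        simp only [Finsupp.coe_tsub, Finsupp.coe_add, Pi.sub_apply, Pi.add_apply,
          Finsupp.single_eq_same] at h1 hub
        omega
      · obtain ⟨c, hc, hc'⟩ := (hcol w).1 ⟨v, hv, hle.trans tsub_le_self⟩
        exact hc' (hw c hc)
  · have hub : (u + w) b ≠ 0 := by
      simp [hwb]
    have hle : Finsupp.single b 1 ≤ w := by
      simpa [Finsupp.single_le_iff] using Nat.one_le_iff_ne_zero.2 hwb
    rw [if_neg hub, if_neg hwb, add_tsub_assoc_of_le hle]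

/-- The chain `y` is a contracting homotopy applied to `c`: it moves the top index of a cell from
the monomial into the exterior part. Cells without a top index, `T ⊆ A` and `w = 0`, are the
unmatched ones and will carry the homology. -/
lemma exists_contraction_chain {s : Set (Fin n →₀ ℕ)} {u : Fin n →₀ ℕ} (A : Finset (Fin n))
    {i d : ℕ} {c : Finset (Fin n) → MvPolynomial (Fin n) K}
    (hc : c ∈ koszulChains (monomialIdeal K (insert u s)) i d) :
    ∃ y ∈ koszulChains (monomialIdeal K (insert u s)) (i + 1) d,
      ∀ (T : Finset (Fin n)) (w : Fin n →₀ ℕ) (a : Fin n), (∀ b ∈ A, w b = 0) →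
        IsTopIndex A T w a → coeff (u + w) (y T) = if a ∈ T then
          koszulSign K (T.erase a) a * coeff (u + w + Finsupp.single a 1) (c (T.erase a))
          else 0 := by
  classical
  let F : Finset (Fin n) → (Fin n →₀ ℕ) → K := fun T m =>
    if u ≤ m then ∑ a ∈ T, if IsTopIndex A T (m - u) a then
      koszulSign K (T.erase a) a * coeff (m + Finsupp.single a 1) (c (T.erase a)) else 0
    else 0
  have key : ∀ T m, F T m ≠ 0 →
      u ≤ m ∧ ∃ a ∈ T, coeff (m + Finsupp.single a 1) (c (T.erase a)) ≠ 0 := by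
    intro T m h
    by_cases hum : u ≤ m
    · refine ⟨hum, ?_⟩
      simp only [F, if_pos hum] at h
      obtain ⟨a, ha, hne⟩ := Finset.exists_ne_zero_of_sum_ne_zero h
      refine ⟨a, ha, ?_⟩
      split_ifs at hne
      · exact right_ne_zero_of_mul hne
      · exact absurd rfl hne
    · simp [F, hum] at h
  obtain ⟨y, hy⟩ := exists_coeff_eq F (by
    intro T
    refine Set.Finite.subset (Finset.finite_toSet (T.biUnion fun a =>
      (c (T.erase a)).support.image fun m => m - Finsupp.single a 1)) ?_
    intro m hm
    obtain ⟨-, a, ha, hne⟩ := key T m hm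
    simp only [Finset.coe_biUnion, Finset.mem_coe, Set.mem_iUnion, Finset.coe_image, Set.mem_image]
    exact ⟨a, ha, m + Finsupp.single a 1, by simpa [mem_support_iff] using hne, by simp⟩)
  refine ⟨y, ?_, ?_⟩
  · rw [mem_koszulChains] at hc ⊢
    intro T m hm
    rw [hy] at hm
    obtain ⟨hum, a, ha, hne⟩ := key T m hm
    obtain ⟨-, h1, h2⟩ := hc _ _ hne
    rw [Finset.card_erase_of_mem ha] at h1
    have hpos := Finset.card_pos.2 ⟨a, ha⟩
    rw [map_add, Finsupp.degree_single] at h2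
    exact ⟨⟨u, Set.mem_insert _ _, hum⟩, by omega, by omega⟩
  · intro T w a hw hT
    rw [hy]
    simp only [F, if_pos (show u ≤ u + w from le_self_add), add_tsub_cancel_left]
    split_ifs with ha
    · rw [Finset.sum_eq_single a, if_pos hT]
      · intro b _ hba
        exact if_neg fun hb => hba (hb.unique hT)
      · exact fun h => absurd ha h
    · refine Finset.sum_eq_zero fun b hb => if_neg fun hb' => ha ?_
      rwa [hT.unique hb']

/-- The homotopy identity `dh + hd = id` off the unmatched cells, with the `hd` term dropped because
`dc` vanishes in the quotient. -/
lemma coeff_sub_koszulDiff_contraction {s : Set (Fin n →₀ ℕ)} {u : Fin n →₀ ℕ}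
    {A : Finset (Fin n)} (hcol : IsLinearColon s u A) {i d : ℕ}
    {c y : Finset (Fin n) → MvPolynomial (Fin n) K}
    (hc : c ∈ koszulChains (monomialIdeal K (insert u s)) i d)
    (hy : y ∈ koszulChains (monomialIdeal K (insert u s)) (i + 1) d)
    (hyc : ∀ (T : Finset (Fin n)) (w : Fin n →₀ ℕ) (a : Fin n), (∀ b ∈ A, w b = 0) →
        IsTopIndex A T w a → coeff (u + w) (y T) = if a ∈ T then
          koszulSign K (T.erase a) a * coeff (u + w + Finsupp.single a 1) (c (T.erase a))
          else 0)
    (hdc : ∀ T w, (∀ b ∈ A, w b = 0) → coeff (u + w) (koszulDiff K n c T) = 0)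
    (T : Finset (Fin n)) (w : Fin n →₀ ℕ) (hw : ∀ b ∈ A, w b = 0) :
    coeff (u + w) (koszulDiff K n y T) = if T ⊆ A ∧ w = 0 then 0 else coeff (u + w) (c T) := by
  rw [coeff_koszulDiff_add hcol hy T hw]
  have hsub : ∀ (e : Fin n →₀ ℕ), ∀ b ∈ A, (w - e) b = 0 := by
    intro e b hb
    simp [hw b hb]
  split_ifs with h
  · simp [h.2]
  obtain ⟨a, ha⟩ := exists_isTopIndex h
  -- Moving a variable other than the top one into `T` leaves the top index unchanged, so every term
  -- of the differential is evaluated with the same `a`.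
  have htop : ∀ b, w b ≠ 0 → b ≠ a → IsTopIndex A (insert b T) (w - Finsupp.single b 1) a := by
    intro b hb hba
    refine ⟨?_, fun e he => ha.2 e ?_⟩
    · rcases ha.1 with h1 | h1
      · left
        rw [Finset.mem_sdiff] at h1 ⊢
        exact ⟨Finset.mem_insert_of_mem h1.1, h1.2⟩
      · right
        simpa [Finsupp.single_apply, hba] using h1
    · rcases he with h1 | h1
      · rw [Finset.mem_sdiff, Finset.mem_insert] at h1
        rcases h1.1 with rfl | h2
        · exact Or.inr hb
        · exact Or.inl (Finset.mem_sdiff.2 ⟨h2, h1.2⟩)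
      · right
        intro h0
        simp [h0] at h1
  by_cases haT : a ∈ T
  · have haA : a ∉ A := by
      rcases ha.1 with h1 | h1
      · exact (Finset.mem_sdiff.1 h1).2
      · exact fun h2 => h1 (hw a h2)
    set R := T.erase a with hR
    have haR : a ∉ R := Finset.notMem_erase a T
    have hTR : insert a R = T := Finset.insert_erase haT
    -- With `a ∈ T`, the vanishing of `dc` at the cell `(T \ {a}, w + a)` expresses the wanted
    -- coefficient of `c` through the other terms, which agree with those of `dy` up to sign.
    have hcyc := hdc R (w + Finsupp.single a 1) (by
      intro b hb
      have : a ≠ b := fun h => haA (h ▸ hb)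
      simp [hw b hb, this])
    rw [coeff_koszulDiff_add hcol hc R (by
      intro b hb
      have : a ≠ b := fun h => haA (h ▸ hb)
      simp [hw b hb, this])] at hcyc
    have hcompl : Rᶜ = insert a Tᶜ := by
      ext b
      simp only [hR, Finset.mem_compl, Finset.mem_erase, Finset.mem_insert]
      tauto
    rw [hcompl, Finset.sum_insert (by simpa using haT), if_neg (by simp), add_tsub_cancel_right,
      hTR] at hcyc
    have hsum : (∑ b ∈ Tᶜ, if w b = 0 then 0 else
        koszulSign K T b * coeff (u + (w - Finsupp.single b 1)) (y (insert b T)))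
        = - koszulSign K R a * ∑ b ∈ Tᶜ, if (w + Finsupp.single a 1 : Fin n →₀ ℕ) b = 0 then 0 else
          koszulSign K R b *
            coeff (u + (w + Finsupp.single a 1 - Finsupp.single b 1)) (c (insert b R)) := by
      rw [Finset.mul_sum]
      refine Finset.sum_congr rfl fun b hb => ?_
      rw [Finset.mem_compl] at hb
      have hba : b ≠ a := fun h => hb (h ▸ haT)
      by_cases hwb : w b = 0
      · simp [hwb, hba.symm]
      · rw [if_neg hwb, if_neg (by simp [hwb]), hyc _ _ a (hsub _) (htop b hwb hba),
          if_pos (Finset.mem_insert_of_mem haT)]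
        have hbR : b ∉ R := fun h => hb (Finset.mem_of_mem_erase h)
        have e1 : (insert b T).erase a = insert b R := Finset.erase_insert_of_ne hba
        have hle : Finsupp.single b 1 ≤ w := by
          simpa [Finsupp.single_le_iff] using Nat.one_le_iff_ne_zero.2 hwb
        have e2 : u + (w - Finsupp.single b 1) + Finsupp.single a 1
            = u + (w + Finsupp.single a 1 - Finsupp.single b 1) := by
          rw [add_assoc, tsub_add_eq_add_tsub hle]
        rw [e1, e2, ← hTR]
        have := koszulSign_swap (R := K) haR hbR (Ne.symm hba)
        have h3 := koszulSign_mul_self (R := K) R a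
        have e3 : koszulSign K (insert a R) b * koszulSign K (insert b R) a
            = - (koszulSign K R a * koszulSign K R b) := by
          have h4 := koszulSign_mul_self (R := K) R b
          have h5 := koszulSign_mul_self (R := K) (insert b R) a
          linear_combination (koszulSign K R a * koszulSign K (insert b R) a) * this
            - (koszulSign K (insert a R) b * koszulSign K (insert b R) a) * h3
            - (koszulSign K R a * koszulSign K R b) * h5
        linear_combination
          (coeff (u + (w + Finsupp.single a 1 - Finsupp.single b 1)) (c (insert b R))) * e3
    rw [hsum]
    have h3 := koszulSign_mul_self (R := K) R a
    linear_combination (-koszulSign K R a) * hcyc + coeff (u + w) (c T) * h3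
  · have hwa : w a ≠ 0 := by
      rcases ha.1 with h1 | h1
      · exact absurd (Finset.mem_sdiff.1 h1).1 haT
      · exact h1
    have haA : a ∉ A := fun h2 => hwa (hw a h2)
    have hle : Finsupp.single a 1 ≤ w := by
      simpa [Finsupp.single_le_iff] using Nat.one_le_iff_ne_zero.2 hwa
    -- With `a ∉ T`, only inserting `a` gives a set containing the top index; this term returns `c
    -- T`.
    rw [Finset.sum_eq_single a]
    · rw [if_neg hwa, hyc _ _ a (hsub _), if_pos (Finset.mem_insert_self _ _),
        Finset.erase_insert haT, add_assoc, tsub_add_cancel_of_le hle, ← mul_assoc,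
        koszulSign_mul_self, one_mul]
      refine ⟨Or.inl (Finset.mem_sdiff.2 ⟨Finset.mem_insert_self _ _, haA⟩), fun e he => ha.2 e ?_⟩
      rcases he with h1 | h1
      · rw [Finset.mem_sdiff, Finset.mem_insert] at h1
        rcases h1.1 with rfl | h2
        · exact Or.inr hwa
        · exact Or.inl (Finset.mem_sdiff.2 ⟨h2, h1.2⟩)
      · right
        intro h0
        simp [h0] at h1
    · intro b _ hba
      by_cases hwb : w b = 0
      · rw [if_pos hwb]
      · rw [if_neg hwb, hyc _ _ a (hsub _) (htop b hwb hba), if_neg, mul_zero]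
        simp [haT, hba.symm]
    · intro h1
      exact absurd (Finset.mem_compl.2 haT) h1

section AddGenerator

variable {s : Set (Fin n →₀ ℕ)} {u : Fin n →₀ ℕ} {A : Finset (Fin n)}

lemma IsLinearColon.notMem (hcol : IsLinearColon s u A) {w : Fin n →₀ ℕ} (hw : ∀ b ∈ A, w b = 0) :
    ¬ ∃ v ∈ s, v ≤ u + w := by
  rw [hcol w]
  rintro ⟨i, hi, h⟩
  exact h (hw i hi)

/-- By linearity of the colon ideal, the monomials of the larger ideal missing from the smaller one
are exactly the `x^(u+w)` with `w` vanishing on `A`. -/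
lemma mem_koszulChains_of_coeff_eq_zero (hcol : IsLinearColon s u A) {i d : ℕ}
    {f : Finset (Fin n) → MvPolynomial (Fin n) K}
    (hf : f ∈ koszulChains (monomialIdeal K (insert u s)) i d)
    (h0 : ∀ T w, (∀ b ∈ A, w b = 0) → coeff (u + w) (f T) = 0) :
    f ∈ koszulChains (monomialIdeal K s) i d := by
  rw [mem_koszulChains] at hf ⊢
  intro T m hm
  obtain ⟨⟨v, hv, hvm⟩, h2⟩ := hf T m hm
  refine ⟨?_, h2⟩
  rcases hv with rfl | hv
  · have e : v + (m - v) = m := add_tsub_cancel_of_le hvm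
    rw [← e, hcol]
    by_contra hne
    push Not at hne
    exact hm (e ▸ h0 T (m - v) hne)
  · exact ⟨v, hv, hvm⟩

/-- For `T ⊆ A` the boundary of `x^u e_T` lies in the smaller ideal, since each `x_a x^u` with `a ∈
A` does. By the vanishing hypothesis it bounds there, and subtracting a bounding chain turns `x^u
e_T` into a cycle with the same leading part. -/
lemma exists_critical_cycle (hcol : IsLinearColon s u A)
    (hvan : ∀ i, ∀ c ∈ koszulCycles (monomialIdeal K s) i (u.degree + (i + 1)),
      c ∈ koszulBoundaries (monomialIdeal K s) i (u.degree + (i + 1)))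
    {i d : ℕ} {T : Finset (Fin n)} (hTA : T ⊆ A) (hTi : T.card = i) (hd : u.degree + i = d) :
    ∃ z ∈ koszulCycles (monomialIdeal K (insert u s)) i d,
      ∀ T' w, (∀ b ∈ A, w b = 0) → coeff (u + w) (z T') = if T' = T ∧ w = 0 then 1 else 0 := by
  classical
  let e : Finset (Fin n) → MvPolynomial (Fin n) K := Pi.single T (monomial u 1)
  have he : ∀ T' m, coeff m (e T') = if T' = T ∧ u = m then 1 else 0 := by
    intro T' m
    by_cases h : T' = T
    · subst h
      simp [e, coeff_monomial]
    · simp [e, h]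
  have hce : e ∈ koszulChains (monomialIdeal K (insert u s)) i d := by
    rw [mem_koszulChains]
    intro T' m hm
    rw [he] at hm
    obtain ⟨rfl, rfl⟩ : T' = T ∧ u = m := by
      by_contra h
      simp [h] at hm
    exact ⟨⟨u, Set.mem_insert _ _, le_rfl⟩, hTi, hd⟩
  have he' : ∀ T' w, coeff (u + w) (e T') = if T' = T ∧ w = 0 then 1 else 0 := by
    intro T' w
    rw [he]
    simp
  suffices h : ∃ y ∈ koszulChains (monomialIdeal K s) i d,
      koszulDiff K n y = koszulDiff K n e by
    obtain ⟨y, hy, hye⟩ := h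
    refine ⟨e - y, mem_koszulCycles.2 ⟨Submodule.sub_mem _ hce
      (koszulChains_mono (Set.subset_insert _ _) _ _ hy), by rw [map_sub, hye, sub_self]⟩, ?_⟩
    intro T' w hw
    rw [Pi.sub_apply, coeff_sub, he', coeff_eq_zero_of_mem_koszulChains hy (hcol.notMem hw),
      sub_zero]
  cases i with
  | zero =>
    exact ⟨0, Submodule.zero_mem _, by
      rw [koszulDiff_eq_zero_of_mem_koszulChains_zero hce, map_zero]⟩
  | succ i =>
    have hde : koszulDiff K n e ∈ koszulChains (monomialIdeal K s) i d := by
      refine mem_koszulChains_of_coeff_eq_zero hcol (koszulDiff_mem_koszulChains hce) ?_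
      intro T' w hw
      rw [coeff_koszulDiff_add hcol hce T' hw]
      refine Finset.sum_eq_zero fun b hb => ?_
      by_cases hwb : w b = 0
      · rw [if_pos hwb]
      · rw [if_neg hwb, he', if_neg, mul_zero]
        rintro ⟨h, -⟩
        exact hwb (hw b (hTA (h ▸ Finset.mem_insert_self b T')))
    subst hd
    obtain ⟨y, hy, hye⟩ := mem_koszulBoundaries.1
      (hvan i _ (mem_koszulCycles.2 ⟨hde, koszulDiff_koszulDiff e⟩))
    exact ⟨y, hy, hye⟩

/-- The homological index set of the cells contributed by a generator `x^u` with linear colon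
ideal `(x_a : a ∈ A)` in bidegree `(i, d)`. -/
def criticalCells (u : Fin n →₀ ℕ) (A : Finset (Fin n)) (i d : ℕ) : Finset (Finset (Fin n)) :=
  (A.powersetCard i).filter fun _ => u.degree + i = d

lemma mem_criticalCells {i d : ℕ} {T : Finset (Fin n)} :
    T ∈ criticalCells u A i d ↔ (T ⊆ A ∧ T.card = i) ∧ u.degree + i = d := by
  simp only [criticalCells, Finset.mem_filter, Finset.mem_powersetCard]

lemma card_criticalCells (i d : ℕ) :
    (criticalCells u A i d).card = if u.degree + i = d then A.card.choose i else 0 := by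
  unfold criticalCells
  split_ifs with h <;> simp [h, Finset.card_powersetCard]

lemma coeff_sum_smul_critical {i d : ℕ}
    {z : criticalCells u A i d → Finset (Fin n) → MvPolynomial (Fin n) K}
    (hz : ∀ T : criticalCells u A i d, ∀ T' w, (∀ b ∈ A, w b = 0) →
      coeff (u + w) (z T T') = if T' = T ∧ w = 0 then 1 else 0)
    (a : criticalCells u A i d → K) (T : Finset (Fin n)) {w : Fin n →₀ ℕ}
    (hw : ∀ b ∈ A, w b = 0) :
    coeff (u + w) ((∑ j, a j • z j) T)
      = if h : T ∈ criticalCells u A i d ∧ w = 0 then a ⟨T, h.1⟩ else 0 := by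
  rw [Finset.sum_apply, coeff_sum]
  simp only [Pi.smul_apply, coeff_smul, hz _ T w hw, smul_eq_mul]
  split_ifs with h
  · rw [Finset.sum_eq_single ⟨T, h.1⟩]
    · simp [h.2]
    · intro b _ hb
      rw [if_neg, mul_zero]
      rintro ⟨h1, -⟩
      exact hb (Subtype.ext h1.symm)
    · intro h1
      exact absurd (Finset.mem_univ _) h1
  · refine Finset.sum_eq_zero fun b _ => ?_
    rw [if_neg, mul_zero]
    rintro ⟨h1, h2⟩
    exact h ⟨h1 ▸ b.2, h2⟩

/-- Only a relative cycle is required: `dc` need not vanish inside the smaller ideal. The lemma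
therefore serves both for spanning, with `c` a cycle, and for independence, with `c` a bounding
chain. -/
lemma exists_reduction (hcol : IsLinearColon s u A) {i d : ℕ}
    {z : criticalCells u A i d → Finset (Fin n) → MvPolynomial (Fin n) K}
    (hzc : ∀ T, z T ∈ koszulCycles (monomialIdeal K (insert u s)) i d)
    (hz : ∀ T : criticalCells u A i d, ∀ T' w, (∀ b ∈ A, w b = 0) →
      coeff (u + w) (z T T') = if T' = T ∧ w = 0 then 1 else 0)
    {c : Finset (Fin n) → MvPolynomial (Fin n) K}
    (hc : c ∈ koszulChains (monomialIdeal K (insert u s)) i d)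
    (hdc : ∀ T w, (∀ b ∈ A, w b = 0) → coeff (u + w) (koszulDiff K n c T) = 0) :
    ∃ y ∈ koszulChains (monomialIdeal K (insert u s)) (i + 1) d,
      ∃ a : criticalCells u A i d → K,
        c - koszulDiff K n y - ∑ j, a j • z j ∈ koszulChains (monomialIdeal K s) i d := by
  obtain ⟨y, hy, hyc⟩ := exists_contraction_chain A hc
  refine ⟨y, hy, fun j => coeff u (c j), ?_⟩
  refine mem_koszulChains_of_coeff_eq_zero hcol (Submodule.sub_mem _ (Submodule.sub_mem _ hc
    (koszulDiff_mem_koszulChains hy)) (Submodule.sum_mem _ fun j _ => Submodule.smul_mem _ _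
      (mem_koszulCycles.1 (hzc j)).1)) ?_
  intro T w hw
  rw [Pi.sub_apply, Pi.sub_apply, coeff_sub, coeff_sub,
    coeff_sub_koszulDiff_contraction hcol hc hy hyc hdc T w hw, coeff_sum_smul_critical hz _ T hw]
  by_cases h0 : w = 0
  · subst h0
    by_cases hT : T ⊆ A
    · rw [if_pos ⟨hT, rfl⟩, add_zero]
      split_ifs with h
      · simp
      · have : coeff u (c T) = 0 := by
          by_contra hne
          obtain ⟨-, h1, h2⟩ := mem_koszulChains.1 hc T u hne
          exact h ⟨mem_criticalCells.2 ⟨⟨hT, h1⟩, h2⟩, rfl⟩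
        simp [this]
    · rw [if_neg (by tauto), dif_neg]
      · simp
      · rintro ⟨h, -⟩
        exact hT (mem_criticalCells.1 h).1.1
  · rw [if_neg (by tauto), dif_neg (by tauto)]
    simp

/-- This is the splitting of the long exact homology sequence: the critical classes lift to cycles,
so the connecting map is zero in degrees `i` and `i + 1`. -/
lemma IsHomologyBasis.add_generator (hcol : IsLinearColon s u A)
    (hvan : ∀ i, ∀ c ∈ koszulCycles (monomialIdeal K s) i (u.degree + (i + 1)),
      c ∈ koszulBoundaries (monomialIdeal K s) i (u.degree + (i + 1)))
    {i d : ℕ} {ι : Type*} [Fintype ι] {z : ι → Finset (Fin n) → MvPolynomial (Fin n) K}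
    (hz : IsHomologyBasis (monomialIdeal K s) i d z) :
    ∃ z' : ι ⊕ criticalCells u A i d → Finset (Fin n) → MvPolynomial (Fin n) K,
      IsHomologyBasis (monomialIdeal K (insert u s)) i d z' := by
  have hcrit : ∀ i, ∃ x : criticalCells u A i d → Finset (Fin n) → MvPolynomial (Fin n) K,
      (∀ T, x T ∈ koszulCycles (monomialIdeal K (insert u s)) i d) ∧
      ∀ T : criticalCells u A i d, ∀ T' w, (∀ b ∈ A, w b = 0) →
        coeff (u + w) (x T T') = if T' = T ∧ w = 0 then 1 else 0 := by
    intro i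
    have h : ∀ T : criticalCells u A i d, _ := fun T => by
      have h := mem_criticalCells.1 T.2
      exact exists_critical_cycle hcol hvan h.1.1 h.1.2 h.2
    choose x hx using h
    exact ⟨x, fun T => (hx T).1, fun T => (hx T).2⟩
  have hmono : ∀ i, koszulChains (monomialIdeal K s) i d
      ≤ koszulChains (monomialIdeal K (insert u s)) i d :=
    fun i => koszulChains_mono (Set.subset_insert _ _) i d
  obtain ⟨x, hxc, hx⟩ := hcrit i
  refine ⟨Sum.elim z x, ?_, ?_, ?_⟩
  · rintro (j | j)
    · have := mem_koszulCycles.1 (hz.mem j)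
      exact mem_koszulCycles.2 ⟨hmono _ this.1, this.2⟩
    · exact hxc j
  · intro c hc
    rw [mem_koszulCycles] at hc
    obtain ⟨y, hy, a, ha⟩ := exists_reduction hcol hxc hx hc.1 (by simp [hc.2])
    have hcyc : c - koszulDiff K n y - ∑ j, a j • x j ∈ koszulCycles (monomialIdeal K s) i d := by
      refine mem_koszulCycles.2 ⟨ha, ?_⟩
      rw [map_sub, map_sub, hc.2, koszulDiff_koszulDiff, map_sum]
      simp [(mem_koszulCycles.1 (hxc _)).2]
    obtain ⟨b, hb⟩ := hz.span _ hcyc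
    obtain ⟨y', hy', hy'e⟩ := mem_koszulBoundaries.1 hb
    refine ⟨Sum.elim b a, mem_koszulBoundaries.2 ⟨y + y', Submodule.add_mem _ hy (hmono _ hy'), ?_⟩⟩
    rw [map_add, hy'e, Fintype.sum_sum_type]
    simp only [Sum.elim_inl, Sum.elim_inr]
    abel
  · intro a ha
    obtain ⟨y, hy, hye⟩ := mem_koszulBoundaries.1 ha
    rw [Fintype.sum_sum_type] at hye
    simp only [Sum.elim_inl, Sum.elim_inr] at hye
    have hzs : ∑ j, a (Sum.inl j) • z j ∈ koszulChains (monomialIdeal K s) i d :=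
      Submodule.sum_mem _ fun j _ => Submodule.smul_mem _ _ (mem_koszulCycles.1 (hz.mem j)).1
    have hz0 : ∀ T w, (∀ b ∈ A, w b = 0) →
        coeff (u + w) ((∑ j, a (Sum.inl j) • z j) T) = 0 :=
      fun T w hw => coeff_eq_zero_of_mem_koszulChains hzs (hcol.notMem hw) T
    -- The coefficient of `x^u` in a boundary vanishes, while in the combination it is exactly the
    -- coefficient of the critical cycle.
    have ha2 : ∀ j, a (Sum.inr j) = 0 := by
      intro T
      have h1 := congrArg (fun f => coeff (u + 0) (f (T : Finset (Fin n)))) hye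
      simp only [Pi.add_apply, coeff_add] at h1
      rw [coeff_koszulDiff_add hcol hy _ (by simp), hz0 _ _ (by simp),
        coeff_sum_smul_critical hx (fun j => a (Sum.inr j)) _ (by simp),
        dif_pos ⟨T.2, rfl⟩] at h1
      simpa using h1.symm
    have hye' : koszulDiff K n y = ∑ j, a (Sum.inl j) • z j := by
      rw [hye]
      simp [ha2]
    -- The bounding chain `y` is a relative cycle in homological degree `i + 1`. Reducing it there
    -- moves it into the smaller ideal without changing its differential, so the old classes already
    -- satisfy the relation.
    obtain ⟨x', hxc', hx'⟩ := hcrit (i + 1)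
    obtain ⟨y2, -, b, hb⟩ := exists_reduction hcol hxc' hx' hy
      (by rw [hye']; exact hz0)
    have ha1 : ∀ j, a (Sum.inl j) = 0 := by
      refine hz.indep _ (mem_koszulBoundaries.2 ⟨_, hb, ?_⟩)
      rw [map_sub, map_sub, koszulDiff_koszulDiff, map_sum, ← hye']
      simp [(mem_koszulCycles.1 (hxc' _)).2]
    rintro (j | j)
    · exact ha1 j
    · exact ha2 j

end AddGenerator

/-- If each generator in the list of exponents `s`, ordered by `f`, has a linear colon ideal with
respect to the earlier ones, the graded Betti numbers are sums of binomial coefficients. -/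
theorem exists_isHomologyBasis {α κ : Type*} [LinearOrder κ] [DecidableEq α] (f : α → κ)
    (e : α → Fin n →₀ ℕ) (A : α → Finset (Fin n)) (G : Finset α)
    (hdeg : ∀ a ∈ G, ∀ b ∈ G, f a ≤ f b → (e a).degree ≤ (e b).degree)
    (hcol : ∀ a ∈ G, ∀ s ⊆ G, a ∉ s → (∀ b ∈ s, f b ≤ f a) → (∀ b ∈ G, f b < f a → b ∈ s) →
      IsLinearColon (e '' s) (e a) (A a)) (i d : ℕ) :
    ∃ (ι : Type) (_ : Fintype ι) (z : ι → Finset (Fin n) → MvPolynomial (Fin n) K),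
      IsHomologyBasis (monomialIdeal K (e '' G)) i d z ∧
      Fintype.card ι = ∑ a ∈ G, if (e a).degree + i = d then (A a).card.choose i else 0 := by
  suffices H : ∀ s : Finset α, s ⊆ G → (∀ a ∈ s, ∀ b ∈ G, f b < f a → b ∈ s) →
      ∀ i d, ∃ (ι : Type) (_ : Fintype ι) (z : ι → Finset (Fin n) → MvPolynomial (Fin n) K),
        IsHomologyBasis (monomialIdeal K (e '' s)) i d z ∧
        Fintype.card ι = ∑ a ∈ s, if (e a).degree + i = d then (A a).card.choose i else 0 from
    H G subset_rfl (fun _ _ b hb _ => hb) i d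
  intro s
  refine Finset.induction_on_max_value f s ?_ ?_
  · intro _ _ i d
    have h0 : ∀ i, ∀ c ∈ koszulChains (monomialIdeal K (e '' ((∅ : Finset α) : Set α))) i d,
        c = 0 := by
      intro i c hc
      funext T
      ext m
      exact coeff_eq_zero_of_mem_koszulChains hc (by simp) T
    refine ⟨Empty, inferInstance, Empty.elim, ⟨fun j => j.elim, fun c hc => ⟨Empty.elim, ?_⟩,
      fun _ _ j => j.elim⟩, by simp⟩
    rw [h0 i c (mem_koszulCycles.1 hc).1]
    simp
  · intro a s has hmax ih hsG hdown i d
    rw [Finset.insert_subset_iff] at hsG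
    have hdown' : ∀ b ∈ G, f b < f a → b ∈ s := fun b hb hlt =>
      (Finset.mem_insert.1 (hdown a (Finset.mem_insert_self _ _) b hb hlt)).resolve_left
        (by rintro rfl; exact lt_irrefl _ hlt)
    have hih := ih hsG.2 fun b hb c hc hlt => hdown' c hc (hlt.trans_le (hmax b hb))
    have hc := hcol a hsG.1 s hsG.2 has hmax hdown'
    obtain ⟨ι, _, z, hz, hcard⟩ := hih i d
    obtain ⟨z', hz'⟩ := hz.add_generator hc (by
      -- Earlier generators have degree at most `deg u`, so their homology in homological degree `j`
      -- stops at internal degree `deg u + j`, one short of the degree needed here.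
      intro j c hcyc
      obtain ⟨ι', _, y, hy, hy'⟩ := hih j ((e a).degree + (j + 1))
      rw [Finset.sum_eq_zero, Fintype.card_eq_zero_iff] at hy'
      · obtain ⟨b, hb⟩ := hy.span c hcyc
        simpa using hb
      · intro b hb
        have := hdeg b (hsG.2 hb) a hsG.1 (hmax b hb)
        rw [if_neg (by omega)])
    refine ⟨ι ⊕ criticalCells (e a) (A a) i d, inferInstance, z', ?_, ?_⟩
    · rwa [Finset.coe_insert, Set.image_insert_eq]
    · rw [Fintype.card_sum, hcard, Finset.sum_insert has, Fintype.card_coe, card_criticalCells,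
        add_comm]

theorem betti_monomialIdeal_eq_sum {α κ : Type*} [LinearOrder κ] [DecidableEq α] (f : α → κ)
    (e : α → Fin n →₀ ℕ) (A : α → Finset (Fin n)) (G : Finset α)
    (hdeg : ∀ a ∈ G, ∀ b ∈ G, f a ≤ f b → (e a).degree ≤ (e b).degree)
    (hcol : ∀ a ∈ G, ∀ s ⊆ G, a ∉ s → (∀ b ∈ s, f b ≤ f a) → (∀ b ∈ G, f b < f a → b ∈ s) →
      IsLinearColon (e '' s) (e a) (A a)) (i d : ℕ) :
    betti (monomialIdeal K (e '' G)) i d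
      = ∑ a ∈ G, if (e a).degree + i = d then (A a).card.choose i else 0 := by
  obtain ⟨ι, _, z, hz, hcard⟩ := exists_isHomologyBasis (K := K) f e A G hdeg hcol i d
  rw [hz.betti_eq, hcard]

/-! ### Spread sets and the dominance order -/

/-- Exponent vector of the squarefree monomial with support `u`. -/
def ind (u : Finset (Fin n)) : Fin n →₀ ℕ :=
  Finsupp.equivFunOnFinite.symm fun i => if i ∈ u then 1 else 0

@[simp] lemma ind_apply (u : Finset (Fin n)) (i : Fin n) : ind u i = if i ∈ u then 1 else 0 := rfl

lemma ind_le {u : Finset (Fin n)} {m : Fin n →₀ ℕ} : ind u ≤ m ↔ ∀ i ∈ u, m i ≠ 0 := by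
  constructor
  · intro h i hi
    have := h i
    rw [ind_apply, if_pos hi] at this
    omega
  · intro h i
    rw [ind_apply]
    split_ifs with hi
    · exact Nat.one_le_iff_ne_zero.2 (h i hi)
    · exact Nat.zero_le _

lemma ind_le_ind {u v : Finset (Fin n)} : ind u ≤ ind v ↔ u ⊆ v := by
  rw [ind_le]
  simp [Finset.subset_iff]

lemma degree_ind (u : Finset (Fin n)) : (ind u).degree = u.card := by
  rw [Finsupp.degree_eq_sum]
  simp

/-- The elements of `u` have pairwise distance at least `t`. -/
def SpreadSet (t : ℕ) (u : Finset (Fin n)) : Prop :=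
  ∀ i ∈ u, ∀ j ∈ u, i < j → (i : ℕ) + t ≤ (j : ℕ)

lemma SpreadSet.subset {t : ℕ} {u v : Finset (Fin n)} (hv : SpreadSet t v) (h : u ⊆ v) :
    SpreadSet t u :=
  fun i hi j hj hij => hv i (h hi) j (h hj) hij

lemma isSpread_ind {t : ℕ} {u : Finset (Fin n)} : IsSpread t (ind u) ↔ SpreadSet t u := by
  constructor
  · intro h i hi j hj hij
    exact h.2 i j (by simp [hi]) (by simp [hj]) hij
  · intro h
    refine ⟨fun i hi => ?_, fun i j hi hj hij => h i (by simpa using hi) j (by simpa using hj) hij⟩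
    rw [ind_apply] at hi
    split_ifs at hi <;> omega

lemma IsSpread.eq_ind {t : ℕ} (ht : 1 ≤ t) {m : Fin n →₀ ℕ} (hm : IsSpread t m) :
    m = ind m.support := by
  ext i
  have h1 : ¬ 2 ≤ m i := fun h => by
    have := hm.1 i h
    omega
  rw [ind_apply]
  split_ifs with h
  · rw [Finsupp.mem_support_iff] at h
    omega
  · rwa [Finsupp.notMem_support_iff] at h

lemma IsSpread.spreadSet_support {t : ℕ} (ht : 1 ≤ t) {m : Fin n →₀ ℕ} (hm : IsSpread t m) :
    SpreadSet t m.support := by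
  rw [← isSpread_ind, ← hm.eq_ind ht]
  exact hm

/-- Number of elements of `u` with value less than `x`. -/
def cnt (u : Finset (Fin n)) (x : ℕ) : ℕ := (u.filter fun b => b.val < x).card

lemma cnt_le_card (u : Finset (Fin n)) (x : ℕ) : cnt u x ≤ u.card :=
  Finset.card_filter_le _ _

lemma cnt_mono (u : Finset (Fin n)) {x y : ℕ} (h : x ≤ y) : cnt u x ≤ cnt u y := by
  refine Finset.card_le_card fun b hb => ?_
  rw [Finset.mem_filter] at hb ⊢
  exact ⟨hb.1, hb.2.trans_le h⟩

lemma cnt_eq_card {u : Finset (Fin n)} {x : ℕ} (h : ∀ b ∈ u, b.val < x) : cnt u x = u.card := by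
  rw [cnt, Finset.filter_true_of_mem h]

lemma cnt_subset {u v : Finset (Fin n)} (h : u ⊆ v) (x : ℕ) : cnt u x ≤ cnt v x :=
  Finset.card_le_card (Finset.filter_subset_filter _ h)

lemma cnt_insert {u : Finset (Fin n)} {a : Fin n} (ha : a ∉ u) (x : ℕ) :
    cnt (insert a u) x = cnt u x + if a.val < x then 1 else 0 := by
  unfold cnt
  rw [Finset.filter_insert]
  split_ifs with h
  · rw [Finset.card_insert_of_notMem (by simp [ha])]
  · rfl

lemma cnt_erase {u : Finset (Fin n)} {a : Fin n} (ha : a ∈ u) (x : ℕ) :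
    cnt (u.erase a) x + (if a.val < x then 1 else 0) = cnt u x := by
  rw [← cnt_insert (Finset.notMem_erase a u), Finset.insert_erase ha]

lemma cnt_succ (u : Finset (Fin n)) (a : Fin n) :
    cnt u (a.val + 1) = cnt u a.val + if a ∈ u then 1 else 0 := by
  by_cases ha : a ∈ u
  · rw [← cnt_erase ha, ← cnt_erase ha a.val]
    have : cnt (u.erase a) (a.val + 1) = cnt (u.erase a) a.val := by
      unfold cnt
      congr 1
      refine Finset.filter_congr fun b hb => ?_
      have : b.val ≠ a.val := fun h => (Finset.mem_erase.1 hb).1 (Fin.ext h)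
      omega
    simp [this, ha]
  · rw [if_neg ha, add_zero]
    unfold cnt
    congr 1
    refine Finset.filter_congr fun b hb => ?_
    have : b.val ≠ a.val := fun h => ha (Fin.ext h ▸ hb)
    omega

/-- The dominance order: `v` lies below `u` if the sorted sequence of `v` is at least as long as
the one of `u` and is termwise smaller. -/
def Dom (v u : Finset (Fin n)) : Prop := ∀ x, cnt u x ≤ cnt v x

lemma Dom.refl (u : Finset (Fin n)) : Dom u u := fun _ => le_rfl

lemma Dom.trans {u v w : Finset (Fin n)} (h1 : Dom u v) (h2 : Dom v w) : Dom u w :=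
  fun x => (h2 x).trans (h1 x)

lemma Dom.of_subset {u v : Finset (Fin n)} (h : u ⊆ v) : Dom v u := fun x => cnt_subset h x

lemma Dom.card_le {u v : Finset (Fin n)} (h : Dom v u) : u.card ≤ v.card := by
  rw [← cnt_eq_card (fun b _ => b.isLt), ← cnt_eq_card (fun b _ => b.isLt)]
  exact h n

lemma dom_exchange {u : Finset (Fin n)} {x b : Fin n} (hb : b ∈ u) (hx : x ∉ u) (hxb : x < b) :
    Dom (insert x (u.erase b)) u := by
  intro y
  rw [cnt_insert (fun h => hx (Finset.mem_of_mem_erase h)), ← cnt_erase hb]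
  rw [Fin.lt_def] at hxb
  split_ifs <;> omega

/-- Sum of the counting function; it increases strictly when moving down in dominance order among
sets of equal size. -/
def cntSum (u : Finset (Fin n)) : ℕ := ∑ x ∈ Finset.range (n + 1), cnt u x

lemma Dom.cntSum_lt {u v : Finset (Fin n)} (h : Dom v u) (hne : u ≠ v) : cntSum u < cntSum v := by
  refine Finset.sum_lt_sum (fun x _ => h x) ?_
  by_contra hall
  push Not at hall
  have heq : ∀ x ≤ n, cnt u x = cnt v x :=
    fun x hx => le_antisymm (h x) (hall x (Finset.mem_range.2 (by omega)))
  refine hne (Finset.ext fun a => ?_)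
  have h1 := heq a a.isLt.le
  have h2 := heq (a + 1) a.isLt
  rw [cnt_succ, cnt_succ, h1] at h2
  by_cases ha : a ∈ u <;> by_cases ha' : a ∈ v <;> simp_all

/-- The variables generating the colon ideal at a minimal generator `x^u`. -/
def gapSet (t : ℕ) (u : Finset (Fin n)) : Finset (Fin n) :=
  Finset.univ.filter fun i => (∃ b ∈ u, i < b) ∧ ∀ b ∈ u, ¬ (b ≤ i ∧ i.val < b.val + t)

lemma mem_gapSet {t : ℕ} {u : Finset (Fin n)} {i : Fin n} :
    i ∈ gapSet t u ↔ (∃ b ∈ u, i < b) ∧ ∀ b ∈ u, ¬ (b ≤ i ∧ i.val < b.val + t) := by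
  simp [gapSet]

/-- The indices below `M` split into `gapSet` and the windows `[b, b + t)` for `b ∈ u`, `b ≠ M`.
Spreadness makes the windows disjoint and keeps them below `M`. -/
lemma card_gapSet {t : ℕ} {u : Finset (Fin n)} (hu : SpreadSet t u) {M : Fin n} (hM : M ∈ u)
    (hmax : ∀ b ∈ u, b ≤ M) : (gapSet t u).card + t * (u.card - 1) = M.val := by
  classical
  let B : Fin n → Finset (Fin n) := fun b => Finset.univ.filter fun i => b ≤ i ∧ i.val < b.val + t
  have hlt : ∀ b ∈ u.erase M, b.val + t ≤ M.val := by
    intro b hb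
    rw [Finset.mem_erase] at hb
    exact hu b hb.2 M hM (lt_of_le_of_ne (hmax b hb.2) hb.1)
  have hB : ∀ b ∈ u.erase M, (B b).card = t := by
    intro b hb
    have h1 := hlt b hb
    have : B b = Finset.Ico b ⟨b.val + t, by omega⟩ := by
      ext i
      simp [B, Fin.lt_def]
    rw [this, Fin.card_Ico]
    simp
  have hunion : Finset.Iio M = gapSet t u ∪ (u.erase M).biUnion B := by
    ext i
    simp only [Finset.mem_Iio, Finset.mem_union, mem_gapSet, Finset.mem_biUnion, B,
      Finset.mem_filter, Finset.mem_univ, true_and]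
    constructor
    · intro hi
      by_cases h : ∃ b ∈ u.erase M, b ≤ i ∧ i.val < b.val + t
      · exact Or.inr h
      · refine Or.inl ⟨⟨M, hM, hi⟩, fun b hb hb' => ?_⟩
        by_cases hbM : b = M
        · subst hbM
          exact absurd hb'.1 hi.not_ge
        · exact h ⟨b, Finset.mem_erase.2 ⟨hbM, hb⟩, hb'⟩
    · rintro (⟨⟨b, hb, hib⟩, -⟩ | ⟨b, hb, hb'⟩)
      · exact hib.trans_le (hmax b hb)
      · have := hlt b hb
        rw [Fin.lt_def]
        omega
  have hdisj : Disjoint (gapSet t u) ((u.erase M).biUnion B) := by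
    rw [Finset.disjoint_left]
    intro i hi hi'
    simp only [Finset.mem_biUnion, B, Finset.mem_filter, Finset.mem_univ, true_and] at hi'
    obtain ⟨b, hb, hb'⟩ := hi'
    exact (mem_gapSet.1 hi).2 b (Finset.mem_of_mem_erase hb) hb'
  have hpair : ∀ b ∈ u.erase M, ∀ b' ∈ u.erase M, b ≠ b' → Disjoint (B b) (B b') := by
    intro b hb b' hb' hne
    rw [Finset.disjoint_left]
    intro i hi hi'
    simp only [B, Finset.mem_filter, Finset.mem_univ, true_and, Fin.le_def] at hi hi'
    have hb1 := Finset.mem_of_mem_erase hb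
    have hb2 := Finset.mem_of_mem_erase hb'
    rcases lt_or_gt_of_ne hne with h | h
    · have := hu b hb1 b' hb2 h
      omega
    · have := hu b' hb2 b hb1 h
      omega
  have hcard := congrArg Finset.card hunion
  rw [Fin.card_Iio, Finset.card_union_of_disjoint hdisj, Finset.card_biUnion hpair,
    Finset.sum_congr rfl hB, Finset.sum_const, Finset.card_erase_of_mem hM, smul_eq_mul] at hcard
  rw [hcard, mul_comm]

/-! ### Minimal generators of strongly stable ideals -/

/-- The monomial `x^u` belongs to `I`. -/
def HasMonomial (I : Ideal (MvPolynomial (Fin n) K)) (u : Finset (Fin n)) : Prop :=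
  monomial (ind u) (1 : K) ∈ I

lemma monomial_mem_of_le {I : Ideal (MvPolynomial (Fin n) K)} {m m' : Fin n →₀ ℕ} (h : m ≤ m')
    (hm : monomial m (1 : K) ∈ I) : monomial m' (1 : K) ∈ I := by
  have : monomial m' (1 : K) = monomial (m' - m) 1 * monomial m 1 := by
    rw [monomial_mul, tsub_add_cancel_of_le h, one_mul]
  rw [this]
  exact I.mul_mem_left _ hm

lemma HasMonomial.mono {I : Ideal (MvPolynomial (Fin n) K)} {u v : Finset (Fin n)}
    (hu : HasMonomial I u) (h : u ⊆ v) : HasMonomial I v :=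
  monomial_mem_of_le (ind_le_ind.2 h) hu

lemma ind_exchange {u : Finset (Fin n)} {i j : Fin n} (hj : j ∈ u) (hi : i ∉ u) :
    ind u - Finsupp.single j 1 + Finsupp.single i 1 = ind (insert i (u.erase j)) := by
  ext x
  have hij : i ≠ j := fun h => hi (h ▸ hj)
  simp only [Finsupp.coe_add, Finsupp.coe_tsub, Pi.add_apply, Pi.sub_apply, ind_apply,
    Finsupp.single_apply, Finset.mem_insert, Finset.mem_erase]
  by_cases h1 : x = i
  · subst h1
    simp [hi]
  · by_cases h2 : x = j
    · subst h2
      simp [hj, hij, h1]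
    · simp [h1, h2, Ne.symm h1, Ne.symm h2]

lemma IsStronglyStable.exchange {t : ℕ} {I : Ideal (MvPolynomial (Fin n) K)}
    (hI : IsStronglyStable t I) {u : Finset (Fin n)} (hu : SpreadSet t u) (hm : HasMonomial I u)
    {i j : Fin n} (hj : j ∈ u) (hi : i ∉ u) (hij : i < j)
    (hs : SpreadSet t (insert i (u.erase j))) : HasMonomial I (insert i (u.erase j)) := by
  have := hI.2 (ind u) (isSpread_ind.2 hu) hm j (by simp [hj]) i hij
  rw [ind_exchange hj hi] at this
  exact this (isSpread_ind.2 hs)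

lemma SpreadSet.exchange {t : ℕ} {u : Finset (Fin n)} (hu : SpreadSet t u) {x b : Fin n}
    (hxb : x < b) (hb : b ∈ u) (hlow : ∀ c ∈ u, c < x → c.val + t ≤ x.val)
    (hgap : ∀ c ∈ u, c < b → c < x) :
    SpreadSet t (insert x (u.erase b)) := by
  have hup : ∀ c ∈ u, c ≠ b → x < c → x.val + t ≤ c.val := by
    intro c hc hcb hxc
    rcases lt_or_gt_of_ne hcb with h | h
    · exact absurd (hgap c hc h) hxc.not_gt
    · have := hu b hb c hc h
      rw [Fin.lt_def] at hxb
      omega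
  intro i hi j hj hij
  rw [Finset.mem_insert, Finset.mem_erase] at hi hj
  rcases hi with rfl | hi <;> rcases hj with rfl | hj
  · exact absurd hij (lt_irrefl _)
  · exact hup j hj.2 hj.1 hij
  · exact hlow i hi.2 hij
  · exact hu i hi.2 j hj.2 hij

/-- At the first index `x` where the sets differ, dominance forces `x ∈ v`. Exchanging the next
element of `u` above `x` for `x` keeps `u` spread and still above `v`, and lowers the sum of its
indices. If there is no such element, `u ⊆ v`. -/
theorem IsStronglyStable.hasMonomial_of_dom {t : ℕ} {I : Ideal (MvPolynomial (Fin n) K)}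
    (hI : IsStronglyStable t I) {u v : Finset (Fin n)} (hu : SpreadSet t u) (hm : HasMonomial I u)
    (hv : SpreadSet t v) (hvu : Dom v u) : HasMonomial I v := by
  classical
  induction hN : (∑ b ∈ u, b.val) using Nat.strong_induction_on generalizing u with
  | _ N ih =>
  by_cases huv : u ⊆ v
  · exact hm.mono huv
  have hne : (symmDiff u v).Nonempty := by
    by_contra h
    rw [Finset.not_nonempty_iff_eq_empty, ← Finset.bot_eq_empty, symmDiff_eq_bot] at h
    exact huv h.le
  obtain ⟨x, hx, hmin⟩ := Finset.exists_min_image _ id hne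
  have hagree : ∀ y, y < x → (y ∈ u ↔ y ∈ v) := by
    intro y hy
    by_contra h
    refine absurd (hmin y ?_) hy.not_ge
    rw [Finset.mem_symmDiff]
    tauto
  have hcx : cnt u x = cnt v x := by
    unfold cnt
    congr 1
    ext y
    simp only [Finset.mem_filter]
    constructor
    · exact fun h => ⟨(hagree y h.2).1 h.1, h.2⟩
    · exact fun h => ⟨(hagree y h.2).2 h.1, h.2⟩
  have hd := hvu (x + 1)
  rw [cnt_succ, cnt_succ, hcx] at hd
  obtain ⟨hxv, hxu⟩ : x ∈ v ∧ x ∉ u := by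
    rcases Finset.mem_symmDiff.1 hx with ⟨h1, h2⟩ | h
    · simp [h1, h2] at hd
    · exact h
  have hP : (u.filter fun b => x < b).Nonempty := by
    by_contra h
    rw [Finset.not_nonempty_iff_eq_empty, Finset.filter_eq_empty_iff] at h
    refine huv fun y hy => (hagree y ?_).1 hy
    exact lt_of_le_of_ne (not_lt.1 (h hy)) fun h' => hxu (h' ▸ hy)
  obtain ⟨b, hb, hbmin⟩ := Finset.exists_min_image _ id hP
  rw [Finset.mem_filter] at hb
  have hgap : ∀ c ∈ u, c < b → c < x := by
    intro c hc hcb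
    by_contra h
    refine absurd (hbmin c (Finset.mem_filter.2 ⟨hc, ?_⟩)) hcb.not_ge
    exact lt_of_le_of_ne (not_lt.1 h) fun h' => hxu (h' ▸ hc)
  have hs : SpreadSet t (insert x (u.erase b)) :=
    hu.exchange hb.2 hb.1 (fun c hc hcx => hv c ((hagree c hcx).1 hc) x hxv hcx) hgap
  refine ih _ ?_ hs (hI.exchange hu hm hb.1 hxu hb.2 hs) ?_ rfl
  · rw [← hN, Finset.sum_insert (fun h => hxu (Finset.mem_of_mem_erase h)),
      ← Finset.add_sum_erase _ _ hb.1]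
    have := Fin.lt_def.1 hb.2
    omega
  · intro y
    have h1 := hvu y
    have h2 := cnt_erase hb.1 y
    rw [cnt_insert (fun h => hxu (Finset.mem_of_mem_erase h))]
    have hxb := Fin.lt_def.1 hb.2
    -- Only thresholds between `x` and `b` see the exchange. There `u` has gained no element since
    -- `x`, while `v` has gained `x` itself, so one extra element is affordable.
    by_cases hy : x.val < y ∧ y ≤ b.val
    · have h3 : cnt u y = cnt u x := by
        unfold cnt
        congr 1
        refine Finset.filter_congr fun c hc => ⟨fun h => ?_, fun h => by omega⟩
        exact hgap c hc (Fin.lt_def.2 (by omega))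
      have h4 := cnt_mono v hy.1
      rw [Nat.succ_eq_add_one, cnt_succ, if_pos hxv] at h4
      rw [if_neg (by omega)] at h2
      rw [if_pos hy.1]
      omega
    · split_ifs at h2 ⊢ <;> omega

open Classical in
/-- Supports of the minimal monomial generators of a `t`-spread ideal. -/
def minGens (t : ℕ) (I : Ideal (MvPolynomial (Fin n) K)) : Finset (Finset (Fin n)) :=
  Finset.univ.filter fun u => SpreadSet t u ∧ HasMonomial I u ∧ ∀ v, v ⊂ u → ¬ HasMonomial I v

lemma mem_minGens {t : ℕ} {I : Ideal (MvPolynomial (Fin n) K)} {u : Finset (Fin n)} :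
    u ∈ minGens t I ↔ SpreadSet t u ∧ HasMonomial I u ∧ ∀ v, v ⊂ u → ¬ HasMonomial I v := by
  simp [minGens]

lemma exists_mem_minGens {t : ℕ} {I : Ideal (MvPolynomial (Fin n) K)} {u : Finset (Fin n)}
    (hu : SpreadSet t u) (hm : HasMonomial I u) : ∃ g ∈ minGens t I, g ⊆ u := by
  induction u using Finset.strongInduction with
  | H u ih =>
  by_cases h : ∃ v, v ⊂ u ∧ HasMonomial I v
  · obtain ⟨v, hv, hvm⟩ := h
    obtain ⟨g, hg, hgv⟩ := ih v hv (hu.subset hv.subset) hvm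
    exact ⟨g, hg, hgv.trans hv.subset⟩
  · push Not at h
    exact ⟨u, mem_minGens.2 ⟨hu, hm, h⟩, subset_rfl⟩

lemma IsSpreadIdeal.eq_monomialIdeal {t : ℕ} (ht : 1 ≤ t) {I : Ideal (MvPolynomial (Fin n) K)}
    (hI : IsSpreadIdeal t I) : I = monomialIdeal K (ind '' (minGens t I : Set (Finset (Fin n)))) := by
  obtain ⟨S, hS, hIS⟩ := hI
  apply le_antisymm
  · conv_lhs => rw [hIS]
    rw [Ideal.span_le]
    rintro _ ⟨m, hm, rfl⟩
    have hmI : monomial m (1 : K) ∈ I := by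
      rw [hIS]
      exact Ideal.subset_span ⟨m, hm, rfl⟩
    have hsp := hS m hm
    obtain ⟨g, hg, hgm⟩ := exists_mem_minGens (I := I) (hsp.spreadSet_support ht)
      (by rw [HasMonomial, ← hsp.eq_ind ht]; exact hmI)
    refine monomial_mem_monomialIdeal.2 ⟨ind g, ⟨g, hg, rfl⟩, ?_⟩
    rw [hsp.eq_ind ht]
    exact ind_le_ind.2 hgm
  · rw [monomialIdeal, Ideal.span_le]
    rintro _ ⟨_, ⟨g, hg, rfl⟩, rfl⟩
    exact (mem_minGens.1 hg).2.1

/-- If `u` lay below the shorter `v`, so would `u` without its largest element, which would then be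
a proper divisor in `I`. -/
lemma IsStronglyStable.not_dom_of_card_lt {t : ℕ} {I : Ideal (MvPolynomial (Fin n) K)}
    (hI : IsStronglyStable t I) {u v : Finset (Fin n)} (hu : u ∈ minGens t I) (hv : SpreadSet t v)
    (hm : HasMonomial I v) (hcard : v.card < u.card) : ¬ Dom u v := by
  intro hd
  rw [mem_minGens] at hu
  obtain ⟨M, hM, hmax⟩ := Finset.exists_max_image u id (Finset.card_pos.1 (by omega))
  refine hu.2.2 _ (Finset.erase_ssubset hM) (hI.hasMonomial_of_dom hv hm
    (hu.1.subset (Finset.erase_subset _ _)) fun x => ?_)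
  have h1 := cnt_erase hM x
  split_ifs at h1 with h
  · rw [cnt_eq_card (u := u) (fun b hb => (Fin.le_def.1 (hmax b hb)).trans_lt h)] at h1
    have := cnt_le_card v x
    omega
  · exact (hd x).trans_eq h1.symm

/-- The order in which the minimal generators have linear colon ideals. -/
def genKey (u : Finset (Fin n)) : ℕ ×ₗ ℕᵒᵈ := toLex (u.card, OrderDual.toDual (cntSum u))

lemma genKey_lt {u v : Finset (Fin n)} :
    genKey u < genKey v ↔ u.card < v.card ∨ u.card = v.card ∧ cntSum v < cntSum u := by
  simp [genKey, Prod.Lex.toLex_lt_toLex]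

lemma card_le_of_genKey_le {u v : Finset (Fin n)} (h : genKey u ≤ genKey v) :
    u.card ≤ v.card := by
  by_contra hlt
  exact h.not_gt (genKey_lt.2 (Or.inl (by omega)))

/-- Below an element of `u`, every element of `v` lies in a window `[b, b + t)` with `b ∈ u`, and a
spread set meets each window at most once. This injects initial parts of `v` into those of `u`. -/
lemma dom_of_disjoint_gapSet {t : ℕ} {u v : Finset (Fin n)} (hv : SpreadSet t v)
    (hcard : v.card ≤ u.card) (hdisj : ∀ i ∈ v, i ∉ gapSet t u) : Dom u v := by
  classical
  intro x
  by_cases hx : ∀ b ∈ u, b.val < x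
  · rw [cnt_eq_card hx]
    exact (cnt_le_card v x).trans hcard
  push Not at hx
  obtain ⟨b0, hb0, hxb0⟩ := hx
  refine Finset.card_le_card_of_forall_subsingleton (fun i b => b ≤ i ∧ i.val < b.val + t) ?_ ?_
  · intro i hi
    rw [Finset.mem_filter] at hi
    have h1 := hdisj i hi.1
    rw [mem_gapSet] at h1
    push Not at h1
    obtain ⟨b, hb, hb1, hb2⟩ := h1 ⟨b0, hb0, Fin.lt_def.2 (by omega)⟩
    exact ⟨b, Finset.mem_filter.2 ⟨hb, (Fin.le_def.1 hb1).trans_lt hi.2⟩, hb1, hb2⟩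
  · rintro b - i ⟨hi, hi1, hi2⟩ j ⟨hj, hj1, hj2⟩
    have hiv := (Finset.mem_filter.1 hi).1
    have hjv := (Finset.mem_filter.1 hj).1
    rw [Fin.le_def] at hi1 hj1
    by_contra hne
    rcases lt_or_gt_of_ne hne with h | h
    · have := hv i hiv j hjv h
      omega
    · have := hv j hjv i hiv h
      omega

/-- An earlier generator dividing `x^u x^w` with `w` off the gaps would be dominated by `u`, against
minimality or the ordering. Conversely, a gap index `i` may replace the next element of `u`, and a
minimal generator dividing the result comes earlier. -/
lemma IsStronglyStable.isLinearColon {t : ℕ} (ht : 1 ≤ t) {I : Ideal (MvPolynomial (Fin n) K)}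
    (hI : IsStronglyStable t I) {u : Finset (Fin n)} (hu : u ∈ minGens t I)
    {s : Finset (Finset (Fin n))} (hs : s ⊆ minGens t I) (hus : u ∉ s)
    (hle : ∀ v ∈ s, genKey v ≤ genKey u) (hlt : ∀ v ∈ minGens t I, genKey v < genKey u → v ∈ s) :
    IsLinearColon (ind '' (s : Set (Finset (Fin n)))) (ind u) (gapSet t u) := by
  classical
  have hu' := mem_minGens.1 hu
  intro w
  constructor
  · rintro ⟨_, ⟨v, hv, rfl⟩, hvw⟩
    by_contra hne
    push Not at hne
    have hv' := mem_minGens.1 (hs hv)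
    have hcard := card_le_of_genKey_le (hle v hv)
    have hdisj : ∀ i ∈ v, i ∉ gapSet t u := by
      intro i hi hgap
      have h1 := ind_le.1 hvw i hi
      rw [Finsupp.add_apply, hne i hgap, add_zero, ind_apply] at h1
      have hiu : i ∈ u := by
        by_contra h
        simp [h] at h1
      exact (mem_gapSet.1 hgap).2 i hiu ⟨le_rfl, by omega⟩
    have hd := dom_of_disjoint_gapSet hv'.1 hcard hdisj
    rcases hcard.lt_or_eq with h | h
    · exact hI.not_dom_of_card_lt hu hv'.1 hv'.2.1 h hd
    · have hvu : v ≠ u := fun h => hus (h ▸ hv)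
      exact (hle v hv).not_gt (genKey_lt.2 (Or.inr ⟨h.symm, hd.cntSum_lt hvu⟩))
  · rintro ⟨i, hi, hwi⟩
    obtain ⟨⟨b0, hb0, hib0⟩, hgap⟩ := mem_gapSet.1 hi
    have hiu : i ∉ u := fun h => hgap i h ⟨le_rfl, by omega⟩
    obtain ⟨b, hb, hbmin⟩ := Finset.exists_min_image (u.filter fun b => i < b) id
      ⟨b0, Finset.mem_filter.2 ⟨hb0, hib0⟩⟩
    rw [Finset.mem_filter] at hb
    have hsp : SpreadSet t (insert i (u.erase b)) := by
      refine hu'.1.exchange hb.2 hb.1 (fun c hc hci => ?_) (fun c hc hcb => ?_)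
      · by_contra h
        exact hgap c hc ⟨hci.le, by omega⟩
      · by_contra h
        refine absurd (hbmin c (Finset.mem_filter.2 ⟨hc, ?_⟩)) hcb.not_ge
        exact lt_of_le_of_ne (not_lt.1 h) fun h' => hiu (h' ▸ hc)
    obtain ⟨g, hg, hgu⟩ := exists_mem_minGens hsp (hI.exchange hu'.1 hu'.2.1 hb.1 hiu hb.2 hsp)
    have hcu : (insert i (u.erase b)).card = u.card := by
      rw [Finset.card_insert_of_notMem (fun h => hiu (Finset.mem_of_mem_erase h)),
        Finset.card_erase_of_mem hb.1]
      have := Finset.card_pos.2 ⟨b, hb.1⟩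
      omega
    refine ⟨ind g, ⟨g, hlt g hg (genKey_lt.2 ?_), rfl⟩, ?_⟩
    · have hgc := Finset.card_le_card hgu
      rw [hcu] at hgc
      rcases hgc.lt_or_eq with h | h
      · exact Or.inl h
      · have : g = insert i (u.erase b) := Finset.eq_of_subset_of_card_le hgu (by omega)
        refine Or.inr ⟨h, ?_⟩
        rw [this]
        refine (dom_exchange hb.1 hiu hb.2).cntSum_lt fun h' => hiu ?_
        rw [h']
        exact Finset.mem_insert_self _ _
    · rw [ind_le]
      intro j hj
      rcases Finset.mem_insert.1 (hgu hj) with rfl | h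
      · simp [hwi]
      · simp [Finset.mem_of_mem_erase h]

theorem IsStronglyStable.betti_eq {t : ℕ} (ht : 1 ≤ t) {I : Ideal (MvPolynomial (Fin n) K)}
    (hI : IsStronglyStable t I) (i j : ℕ) :
    betti I i (i + j) = ∑ u ∈ minGens t I with u.card = j, (gapSet t u).card.choose i := by
  classical
  have h := betti_monomialIdeal_eq_sum (K := K) genKey ind (gapSet t) (minGens t I)
    (fun a _ b _ hab => by rw [degree_ind, degree_ind]; exact card_le_of_genKey_le hab)
    (fun a ha s hs has hle hlt => hI.isLinearColon ht ha hs has hle hlt) i (i + j)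
  rw [← hI.1.eq_monomialIdeal ht] at h
  rw [h, Finset.sum_filter]
  refine Finset.sum_congr rfl fun u _ => ?_
  rw [degree_ind]
  congr 1
  exact propext (by omega)

/-! ### Corners -/

lemma IsStronglyStable.betti_ne_zero_iff {t : ℕ} (ht : 1 ≤ t) {I : Ideal (MvPolynomial (Fin n) K)}
    (hI : IsStronglyStable t I) (i j : ℕ) :
    betti I i (i + j) ≠ 0 ↔ ∃ u ∈ minGens t I, u.card = j ∧ i ≤ (gapSet t u).card := by
  rw [hI.betti_eq ht, Ne, Finset.sum_eq_zero_iff]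
  simp only [Finset.mem_filter, Nat.choose_eq_zero_iff]
  push Not
  exact ⟨fun ⟨u, hu, h⟩ => ⟨u, hu.1, hu.2, h⟩, fun ⟨u, hu, hc, h⟩ => ⟨u, ⟨hu, hc⟩, h⟩⟩

theorem IsStronglyStable.isCorner_iff {t : ℕ} (ht : 1 ≤ t) {I : Ideal (MvPolynomial (Fin n) K)}
    (hI : IsStronglyStable t I) (a l : ℕ) :
    IsCorner I a l ↔ (∃ u ∈ minGens t I, u.card = l ∧ (gapSet t u).card = a) ∧
      ∀ v ∈ minGens t I, (v.card = l → (gapSet t v).card ≤ a) ∧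
        (l < v.card → (gapSet t v).card < a) := by
  unfold IsCorner
  rw [hI.betti_ne_zero_iff ht]
  have hzero : ∀ i j, betti I i (i + j) = 0 ↔
      ∀ u ∈ minGens t I, u.card = j → (gapSet t u).card < i := by
    intro i j
    rw [← not_iff_not, ← ne_eq, hI.betti_ne_zero_iff ht]
    push Not
    rfl
  simp only [hzero]
  constructor
  · rintro ⟨⟨u, hu, hul, hua⟩, h⟩
    have hlt : ∀ v ∈ minGens t I, v.card = l → (gapSet t v).card ≤ a := by
      intro v hv hvl
      have := h (a + 1) l (by omega) le_rfl (by simp) v hv hvl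
      omega
    refine ⟨⟨u, hu, hul, le_antisymm (hlt u hu hul) hua⟩, fun v hv => ⟨hlt v hv, fun hvl => ?_⟩⟩
    exact h a v.card le_rfl hvl.le (by simp; omega) v hv rfl
  · rintro ⟨⟨u, hu, hul, hua⟩, h⟩
    refine ⟨⟨u, hu, hul, hua.ge⟩, fun i j hi hj hne v hv hvj => ?_⟩
    rcases hj.lt_or_eq with hj | rfl
    · have := (h v hv).2 (by omega)
      omega
    · have := (h v hv).1 hvj
      have : i ≠ a := fun h => hne (by rw [h])
      omega

/-- At a corner every binomial coefficient in the Betti formula has lower entry at least its upper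
entry, so it is 0 or 1 and the sum is a count. -/
theorem IsStronglyStable.betti_eq_of_isCorner {t : ℕ} (ht : 1 ≤ t)
    {I : Ideal (MvPolynomial (Fin n) K)} (hI : IsStronglyStable t I) {a l : ℕ}
    (h : IsCorner I a l) :
    betti I a (a + l) = ((minGens t I).filter
      fun u => u.card = l ∧ (gapSet t u).card = a).card := by
  rw [hI.isCorner_iff ht] at h
  rw [hI.betti_eq ht, Finset.card_eq_sum_ones, Finset.sum_filter, Finset.sum_filter]
  refine Finset.sum_congr rfl fun u hu => ?_
  by_cases hl : u.card = l
  · rw [if_pos hl]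
    rcases ((h.2 u hu).1 hl).lt_or_eq with hlt | heq
    · rw [Nat.choose_eq_zero_of_lt hlt, if_neg (by omega)]
    · rw [heq, Nat.choose_self, if_pos ⟨hl, rfl⟩]
  · rw [if_neg hl, if_neg (fun h => hl h.1)]

/-! ### Enumerations of sets of indices -/

/-- `v` consists of the variables with (one-based) indices `f 0 < f 1 < ⋯ < f (m - 1)`. -/
structure Enumerates (f : ℕ → ℕ) (m : ℕ) (v : Finset (Fin n)) : Prop where
  lt : ∀ i j, i < j → j < m → f i < f j
  pos : ∀ i < m, 1 ≤ f i
  le : ∀ i < m, f i ≤ n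
  mem : ∀ x : Fin n, x ∈ v ↔ ∃ i < m, x.val + 1 = f i

lemma exists_enumerates (v : Finset (Fin n)) : ∃ f, Enumerates f v.card v := by
  let e := v.orderEmbOfFin rfl
  refine ⟨fun i => if h : i < v.card then (e ⟨i, h⟩).val + 1 else 0, ?_, ?_, ?_, ?_⟩
  · intro i j hij hj
    have hlt : e ⟨i, hij.trans hj⟩ < e ⟨j, hj⟩ := e.lt_iff_lt.2 hij
    simp only [dif_pos hj, dif_pos (hij.trans hj)]
    rw [Fin.lt_def] at hlt
    omega
  · intro i hi
    simp [hi]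
  · intro i hi
    simp only [dif_pos hi]
    exact (e ⟨i, hi⟩).isLt
  · intro x
    have hr : x ∈ v ↔ x ∈ Set.range e := by
      rw [Finset.range_orderEmbOfFin, Finset.mem_coe]
    rw [hr]
    constructor
    · rintro ⟨⟨i, hi⟩, rfl⟩
      exact ⟨i, hi, by simp [hi]⟩
    · rintro ⟨i, hi, h⟩
      refine ⟨⟨i, hi⟩, Fin.ext ?_⟩
      simp only [dif_pos hi] at h
      omega

namespace Enumerates

variable {f g : ℕ → ℕ} {m m' : ℕ} {u v : Finset (Fin n)}

/-- Translates counting into sorted sequences. `cnt` tests zero-based values with `<`, which is `≤`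
for the one-based `f`. -/
lemma lt_cnt_iff (h : Enumerates f m v) {i x : ℕ} : i < cnt v x ↔ i < m ∧ f i ≤ x := by
  have hcnt : cnt v x = ((Finset.range m).filter fun i => f i ≤ x).card := by
    symm
    refine Finset.card_bij (fun i hi => ⟨f i - 1, ?_⟩) ?_ ?_ ?_
    · have hi := Finset.mem_range.1 (Finset.mem_filter.1 hi).1
      have := h.pos i hi
      have := h.le i hi
      omega
    · intro i hi
      rw [Finset.mem_filter, Finset.mem_range] at hi
      have := h.pos i hi.1
      rw [Finset.mem_filter, h.mem]
      exact ⟨⟨i, hi.1, by dsimp only; omega⟩, by dsimp only; omega⟩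
    · intro i hi j hj hij
      rw [Finset.mem_filter, Finset.mem_range] at hi hj
      have := h.pos i hi.1
      have := h.pos j hj.1
      rw [Fin.mk.injEq] at hij
      by_contra hne
      rcases lt_or_gt_of_ne hne with hlt | hlt
      · have := h.lt i j hlt hj.1
        omega
      · have := h.lt j i hlt hi.1
        omega
    · intro b hb
      rw [Finset.mem_filter, h.mem] at hb
      obtain ⟨⟨i, hi, hbi⟩, hbx⟩ := hb
      exact ⟨i, Finset.mem_filter.2 ⟨Finset.mem_range.2 hi, by omega⟩, Fin.ext (by dsimp only; omega)⟩
  rw [hcnt]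
  constructor
  · intro hi
    by_contra hne
    refine hi.not_ge ?_
    refine (Finset.card_le_card fun j hj => ?_).trans_eq (Finset.card_range i)
    rw [Finset.mem_filter, Finset.mem_range] at hj
    rw [Finset.mem_range]
    by_contra hij
    refine hne ⟨by omega, ?_⟩
    rcases (not_lt.1 hij).lt_or_eq with hlt | rfl
    · exact (h.lt i j hlt hj.1).le.trans hj.2
    · exact hj.2
  · rintro ⟨him, hix⟩
    refine Nat.lt_of_succ_le ?_
    refine (Finset.card_range (i + 1)).symm.trans_le (Finset.card_le_card fun j hj => ?_)
    rw [Finset.mem_range] at hj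
    rw [Finset.mem_filter, Finset.mem_range]
    refine ⟨by omega, ?_⟩
    rcases (Nat.lt_succ_iff.1 hj).lt_or_eq with hlt | rfl
    · exact (h.lt j i hlt him).le.trans hix
    · exact hix

lemma card_eq (h : Enumerates f m v) : v.card = m := by
  rw [← cnt_eq_card (x := n) (fun b _ => b.isLt)]
  refine le_antisymm (le_of_not_gt fun hlt => ?_) (le_of_not_gt fun hlt => ?_)
  · exact lt_irrefl _ (h.lt_cnt_iff.1 hlt).1
  · exact lt_irrefl _ (h.lt_cnt_iff.2 ⟨hlt, h.le _ hlt⟩)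

lemma dom_iff (hv : Enumerates f m v) (hu : Enumerates g m' u) :
    Dom v u ↔ m' ≤ m ∧ ∀ i < m', f i ≤ g i := by
  constructor
  · intro h
    refine ⟨?_, fun i hi => (hv.lt_cnt_iff.1 ((hu.lt_cnt_iff.2 ⟨hi, le_rfl⟩).trans_le (h _))).2⟩
    rw [← hv.card_eq, ← hu.card_eq]
    exact h.card_le
  · rintro ⟨hm, h⟩ x
    by_contra hlt
    obtain ⟨h1, h2⟩ := hu.lt_cnt_iff.1 (not_le.1 hlt)
    exact lt_irrefl _ (hv.lt_cnt_iff.2 ⟨h1.trans_le hm, (h _ h1).trans h2⟩)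

lemma eq_of_forall_eq (hv : Enumerates f m v) (hu : Enumerates g m u) (h : ∀ i < m, f i = g i) :
    v = u := by
  ext x
  rw [hv.mem, hu.mem]
  exact exists_congr fun i => and_congr_right fun hi => by rw [h i hi]

lemma add_le {t : ℕ} (h : Enumerates f m v) (hs : SpreadSet t v) {i : ℕ} (hi : i + 1 < m) :
    f i + t ≤ f (i + 1) := by
  have h1 := h.pos i (by omega)
  have h2 := h.le i (by omega)
  have h3 := h.le (i + 1) hi
  have h4 := h.lt i (i + 1) (by omega) hi
  have := hs ⟨f i - 1, by omega⟩ ((h.mem _).2 ⟨i, by omega, by dsimp only; omega⟩)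
    ⟨f (i + 1) - 1, by omega⟩ ((h.mem _).2 ⟨i + 1, by omega, by dsimp only; omega⟩)
    (by rw [Fin.lt_def]; dsimp only; omega)
  dsimp only at this
  omega

lemma add_mul_le {t : ℕ} (h : Enumerates f m v) (hs : SpreadSet t v) {i : ℕ} (j : ℕ)
    (hi : i + j < m) : f i + t * j ≤ f (i + j) := by
  induction j with
  | zero => simp
  | succ j ih =>
    have h1 := ih (by omega)
    have h2 := h.add_le hs (i := i + j) (by omega)
    rw [Nat.mul_succ, ← add_assoc i j 1]
    omega

lemma spreadSet {t : ℕ} (h : Enumerates f m v) (hf : ∀ i, i + 1 < m → f i + t ≤ f (i + 1)) :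
    SpreadSet t v := by
  intro x hx y hy hxy
  obtain ⟨i, hi, hxi⟩ := (h.mem x).1 hx
  obtain ⟨j, hj, hyj⟩ := (h.mem y).1 hy
  rw [Fin.lt_def] at hxy
  have hij : i < j := by
    by_contra hle
    rcases (not_lt.1 hle).lt_or_eq with hlt | heq
    · have := h.lt j i hlt hi
      omega
    · rw [heq] at hyj
      omega
  have h1 := hf i (by omega)
  have h2 : f (i + 1) ≤ f j := by
    rcases (Nat.succ_le_of_lt hij).lt_or_eq with hlt | heq
    · exact (h.lt _ _ hlt hj).le
    · exact heq ▸ le_rfl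
  omega

lemma card_gapSet_add {t : ℕ} (h : Enumerates f m v) (hs : SpreadSet t v) (hm : 1 ≤ m) :
    (gapSet t v).card + t * (m - 1) + 1 = f (m - 1) := by
  have h1 := h.pos (m - 1) (by omega)
  have h2 := h.le (m - 1) (by omega)
  have := card_gapSet hs (M := ⟨f (m - 1) - 1, by omega⟩)
    ((h.mem _).2 ⟨m - 1, by omega, by dsimp only; omega⟩) (by
      intro b hb
      obtain ⟨i, hi, hbi⟩ := (h.mem b).1 hb
      rw [Fin.le_def]
      dsimp only
      by_cases him : i = m - 1
      · subst him
        omega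
      · have := h.lt i (m - 1) (by omega) (by omega)
        omega)
  rw [h.card_eq] at this
  dsimp only at this
  omega

end Enumerates

/-! ### The upper bound -/

lemma HasInitialDegree.le_card {I : Ideal (MvPolynomial (Fin n) K)} {q : ℕ}
    (h : HasInitialDegree I q) {u : Finset (Fin n)} (hu : HasMonomial I u) : q ≤ u.card :=
  h.2 ⟨_, hu, by simp, by
    rw [← degree_ind u]
    exact isHomogeneous_monomial _ rfl⟩

lemma IsStronglyStable.isCorner_fst_eq {t : ℕ} (ht : 1 ≤ t) {I : Ideal (MvPolynomial (Fin n) K)}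
    (hI : IsStronglyStable t I) {a b l : ℕ} (ha : IsCorner I a l) (hb : IsCorner I b l) :
    a = b := by
  rw [hI.isCorner_iff ht] at ha hb
  obtain ⟨⟨u, hu, hul, hua⟩, ha⟩ := ha
  obtain ⟨⟨v, hv, hvl, hvb⟩, hb⟩ := hb
  have h1 := (ha v hv).1 hvl
  have h2 := (hb u hu).1 hul
  omega

/-- A spread monomial of degree `k + 2` would need an index at least `1 + (k + 1) t`, which exceeds
`d + k t` as `d ≤ t`. -/
lemma IsStronglyStable.snd_le_of_isCorner {t k d : ℕ} (ht : 1 ≤ t) (hdt : d ≤ t)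
    {I : Ideal (MvPolynomial (Fin (d + k * t)) K)} (hI : IsStronglyStable t I) {a l : ℕ}
    (h : IsCorner I a l) : l ≤ k + 1 := by
  rw [hI.isCorner_iff ht] at h
  obtain ⟨⟨u, hu, hul, -⟩, -⟩ := h
  obtain ⟨f, hf⟩ := exists_enumerates u
  rw [hul] at hf
  by_contra hlt
  have h1 := hf.add_mul_le (mem_minGens.1 hu).1 (i := 0) (k + 1) (by omega)
  have h2 := hf.le (0 + (k + 1)) (by omega)
  have h3 := hf.pos 0 (by omega)
  have h4 : t * (k + 1) = k * t + t := by ring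
  omega

/-- The corner conditions give `a > b > c`, hence lower bounds for the last indices in degrees 2 and
3. The degree `k + 1` generator satisfies `e i ≤ d + t i`. Some two of the three generators are then
comparable, against minimality of the longer one. -/
lemma IsStronglyStable.not_isCorner_three_and_last {t k d : ℕ} (ht : 1 ≤ t) (hk : 3 ≤ k)
    (hd : d ≤ 2) {I : Ideal (MvPolynomial (Fin (d + k * t)) K)} (hI : IsStronglyStable t I)
    {a b c : ℕ} (h2 : IsCorner I a 2) (h3 : IsCorner I b 3) : ¬ IsCorner I c (k + 1) := by
  intro h
  rw [hI.isCorner_iff ht] at h2 h3 h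
  obtain ⟨⟨u, hu, hul, hua⟩, h2⟩ := h2
  obtain ⟨⟨v, hv, hvl, hvb⟩, h3⟩ := h3
  obtain ⟨⟨w, hw, hwl, hwc⟩, -⟩ := h
  have hba := (h2 v hv).2 (by omega)
  have hcb := (h3 w hw).2 (by omega)
  have hu' := mem_minGens.1 hu
  have hv' := mem_minGens.1 hv
  have hw' := mem_minGens.1 hw
  obtain ⟨f, hf⟩ := exists_enumerates u
  obtain ⟨g, hg⟩ := exists_enumerates v
  obtain ⟨e, he⟩ := exists_enumerates w
  rw [hul] at hf
  rw [hvl] at hg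
  rw [hwl] at he
  have hf1 := hf.card_gapSet_add hu'.1 (by omega)
  have hg2 := hg.card_gapSet_add hv'.1 (by omega)
  have hek := he.card_gapSet_add hw'.1 (by omega)
  simp only [Nat.add_one_sub_one] at hf1 hg2 hek
  have hf0 := hf.pos 0 (by omega)
  have hg0 := hg.pos 0 (by omega)
  have hg01 := hg.add_le hv'.1 (i := 0) (by omega)
  have hg12 := hg.add_le hv'.1 (i := 1) (by omega)
  simp only [zero_add, Nat.reduceAdd] at hg01 hg12
  have he0 := he.pos 0 (by omega)
  have hen := he.le k (by omega)
  have e1 : t * 1 = t := mul_one t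
  have e2 : t * 2 = t + t := mul_two t
  have ek : t * k = k * t := mul_comm t k
  have hup : ∀ i ≤ k, e i + t * (k - i) ≤ d + k * t := by
    intro i hi
    have := he.add_mul_le hw'.1 (i := i) (k - i) (by omega)
    rw [Nat.add_sub_cancel' hi] at this
    omega
  have hupd : ∀ i ≤ k, e i ≤ d + t * i := by
    intro i hi
    have h1 := hup i hi
    have h2 : t * (k - i) + t * i = k * t := by
      rw [← mul_add, Nat.sub_add_cancel hi, mul_comm]
    omega
  have hw1 := hupd 1 (by omega)
  have hw2 := hupd 2 (by omega)
  have hw0 := hupd 0 (by omega)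
  have hlast := he.add_mul_le hw'.1 (i := 0) k (by omega)
  rw [zero_add] at hlast
  -- Here `f 1 = a + t + 1 ≥ t + 3`, while `e 1 ≤ t + 2`; so `e 0 = 1` puts `w` below `u`.
  by_cases he1 : e 0 = 1
  · refine hI.not_dom_of_card_lt hw hu'.1 hu'.2.1 (by omega)
      ((he.dom_iff hf).2 ⟨by omega, fun i hi => ?_⟩)
    interval_cases i <;> omega
  -- Now `d = 2` and `e i = 2 + t i` for `i ≤ 2`. If `g 0 = 1`, then `g 1 ≤ b + t + 1 < f 1` puts
  -- `v` below `u`; otherwise `g i ≥ 2 + t i` puts `w` below `v`.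
  · by_cases hg1 : g 0 = 1
    · refine hI.not_dom_of_card_lt hv hu'.1 hu'.2.1 (by omega)
        ((hg.dom_iff hf).2 ⟨by omega, fun i hi => ?_⟩)
      interval_cases i <;> omega
    · refine hI.not_dom_of_card_lt hw hv'.1 hv'.2.1 (by omega)
        ((he.dom_iff hg).2 ⟨by omega, fun i hi => ?_⟩)
      interval_cases i <;> omega

theorem IsStronglyStable.finite_corners_and_ncard_le {t k d : ℕ} (ht : 1 ≤ t) (hk : 3 ≤ k)
    (hdt : d ≤ t) {I : Ideal (MvPolynomial (Fin (d + k * t)) K)} (hI : IsStronglyStable t I)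
    (hin : HasInitialDegree I 2) {a : ℕ} (ha : IsCorner I a 2) :
    (corners I).Finite ∧ (corners I).ncard ≤ if d ≤ 2 then k - 1 else k := by
  classical
  have hge : ∀ b l, IsCorner I b l → 2 ≤ l := by
    intro b l h
    rw [hI.isCorner_iff ht] at h
    obtain ⟨⟨u, hu, hul, -⟩, -⟩ := h
    exact hul ▸ hin.le_card (mem_minGens.1 hu).2.1
  have hinj : Set.InjOn Prod.snd (corners I) := by
    rintro ⟨b, l⟩ h ⟨c, l'⟩ h' (rfl : l = l')
    have hbc : b = c := hI.isCorner_fst_eq ht h h'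
    rw [hbc]
  have hbound : ∀ S : Finset ℕ, (∀ b l, IsCorner I b l → l ∈ S) →
      (corners I).Finite ∧ (corners I).ncard ≤ S.card := by
    intro S hS
    have hsub : Prod.snd '' corners I ⊆ (S : Set ℕ) := by
      rintro _ ⟨⟨b, l⟩, h, rfl⟩
      exact hS b l h
    refine ⟨Set.Finite.of_finite_image (S.finite_toSet.subset hsub) hinj, ?_⟩
    rw [← hinj.ncard_image, ← Set.ncard_coe_finset S]
    exact Set.ncard_le_ncard hsub S.finite_toSet
  have hmem : ∀ b l, IsCorner I b l → l ∈ Finset.Icc 2 (k + 1) := fun b l h =>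
    Finset.mem_Icc.2 ⟨hge b l h, hI.snd_le_of_isCorner ht hdt h⟩
  have hcard : (Finset.Icc 2 (k + 1)).card = k := by
    rw [Nat.card_Icc]
    omega
  split_ifs with hd
  · by_cases h3 : ∃ b, IsCorner I b 3
    · obtain ⟨b, hb⟩ := h3
      have := hbound ((Finset.Icc 2 (k + 1)).erase (k + 1)) fun c l h =>
        Finset.mem_erase.2 ⟨fun hl => hI.not_isCorner_three_and_last ht hk hd ha hb (hl ▸ h),
          hmem c l h⟩
      rwa [Finset.card_erase_of_mem (by simp; omega), hcard] at this
    · have := hbound ((Finset.Icc 2 (k + 1)).erase 3) fun c l h =>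
        Finset.mem_erase.2 ⟨fun hl => h3 ⟨c, hl ▸ h⟩, hmem c l h⟩
      rwa [Finset.card_erase_of_mem (by simp; omega), hcard] at this
  · have := hbound _ hmem
    rwa [hcard] at this

/-! ### Values of the floor in the bound. -/

lemma floor_eq_of_le_two {t d : ℕ} (ht : 2 ≤ t) (hd : 1 ≤ d) (hd2 : d ≤ 2) :
    ⌊((d : ℚ) - 3) / t⌋ = -1 := by
  have ht0 : (0 : ℚ) < t := by
    exact_mod_cast (by omega : 0 < t)
  have h1 : (2 : ℚ) ≤ t := by exact_mod_cast ht
  have h2 : (1 : ℚ) ≤ d := by exact_mod_cast hd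
  have h3 : (d : ℚ) ≤ 2 := by exact_mod_cast hd2
  rw [Int.floor_eq_iff]
  constructor
  · rw [le_div_iff₀ ht0]
    push_cast
    linarith
  · rw [div_lt_iff₀ ht0]
    push_cast
    linarith

lemma floor_eq_of_three_le {t d : ℕ} (hd : 3 ≤ d) (hdt : d ≤ t) :
    ⌊((d : ℚ) - 3) / t⌋ = 0 := by
  have ht0 : (0 : ℚ) < t := by
    exact_mod_cast (by omega : 0 < t)
  have h2 : (3 : ℚ) ≤ d := by exact_mod_cast hd
  have h3 : (d : ℚ) ≤ t := by exact_mod_cast hdt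
  rw [Int.floor_eq_iff]
  constructor
  · rw [le_div_iff₀ ht0]
    push_cast
    linarith
  · rw [div_lt_iff₀ ht0]
    push_cast
    linarith

/-! ### Strongly stable ideals generated by a set of spread monomials -/

/-- The ideal spanned by the `t`-spread monomials below some element of `W`. -/
def dominatedIdeal (K : Type*) [Field K] (t : ℕ) (W : Set (Finset (Fin n))) :
    Ideal (MvPolynomial (Fin n) K) :=
  monomialIdeal K (ind '' {v | SpreadSet t v ∧ ∃ w ∈ W, Dom v w})

lemma hasMonomial_dominatedIdeal {t : ℕ} {W : Set (Finset (Fin n))} {v : Finset (Fin n)} :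
    HasMonomial (dominatedIdeal K t W) v ↔ ∃ g ⊆ v, SpreadSet t g ∧ ∃ w ∈ W, Dom g w := by
  rw [HasMonomial, dominatedIdeal, monomial_mem_monomialIdeal]
  constructor
  · rintro ⟨_, ⟨g, hg, rfl⟩, hle⟩
    exact ⟨g, ind_le_ind.1 hle, hg⟩
  · rintro ⟨g, hgv, hg⟩
    exact ⟨_, ⟨g, hg, rfl⟩, ind_le_ind.2 hgv⟩

lemma HasMonomial.exists_dom {t : ℕ} {W : Set (Finset (Fin n))} {v : Finset (Fin n)}
    (h : HasMonomial (dominatedIdeal K t W) v) : ∃ w ∈ W, Dom v w := by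
  obtain ⟨g, hgv, -, w, hw, hd⟩ := hasMonomial_dominatedIdeal.1 h
  exact ⟨w, hw, (Dom.of_subset hgv).trans hd⟩

lemma SpreadSet.hasMonomial_dominatedIdeal {t : ℕ} {W : Set (Finset (Fin n))}
    {v w : Finset (Fin n)} (hv : SpreadSet t v) (hw : w ∈ W) (h : Dom v w) :
    HasMonomial (dominatedIdeal K t W) v :=
  TSpread.hasMonomial_dominatedIdeal.2 ⟨v, subset_rfl, hv, w, hw, h⟩

lemma isStronglyStable_dominatedIdeal {t : ℕ} (ht : 1 ≤ t) (W : Set (Finset (Fin n))) :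
    IsStronglyStable t (dominatedIdeal K t W) := by
  refine ⟨⟨_, ?_, rfl⟩, ?_⟩
  · rintro _ ⟨v, hv, rfl⟩
    exact isSpread_ind.2 hv.1
  · intro m hm hmI j hj i hij hs
    obtain ⟨u, rfl⟩ : ∃ u, m = ind u := ⟨_, hm.eq_ind ht⟩
    have hju : j ∈ u := by
      by_contra h
      simp [h] at hj
    have hiu : i ∉ u := by
      intro h
      have := hs.1 i (by simp [h, hij.ne'])
      omega
    rw [ind_exchange hju hiu] at hs ⊢
    obtain ⟨w, hw, hd⟩ := HasMonomial.exists_dom (K := K) hmI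
    exact (isSpread_ind.1 hs).hasMonomial_dominatedIdeal hw ((dom_exchange hju hiu hij).trans hd)

theorem borelIdeal_eq_dominatedIdeal {t : ℕ} (ht : 1 ≤ t) {W : Set (Finset (Fin n))}
    (hW : ∀ w ∈ W, SpreadSet t w) : borelIdeal K t (ind '' W) = dominatedIdeal K t W := by
  apply le_antisymm
  · refine sInf_le ⟨isStronglyStable_dominatedIdeal ht W, ?_⟩
    rintro _ ⟨w, hw, rfl⟩
    exact (hW w hw).hasMonomial_dominatedIdeal hw (Dom.refl w)
  · refine le_sInf ?_
    rintro I ⟨hI, hIW⟩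
    rw [dominatedIdeal, monomialIdeal, Ideal.span_le]
    rintro _ ⟨_, ⟨v, ⟨hv, w, hw, hd⟩, rfl⟩, rfl⟩
    exact hI.hasMonomial_of_dom (hW w hw) (hIW _ ⟨w, hw, rfl⟩) hv hd

/-! ### Index sequences of the basic monomials -/

/-- The sequence `2, 3 + t, 4 + 2t, …`. -/
def stair (t i : ℕ) : ℕ := 2 + i + i * t

lemma stair_succ (t i : ℕ) : stair t (i + 1) = stair t i + t + 1 := by
  unfold stair
  ring

/-- Index sequence of the `j`-th forward monomial. -/
def IsForwardSeq (t j : ℕ) (g : ℕ → ℕ) : Prop :=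
  (∀ i < j, g i = stair t i) ∧ g j + 1 = stair t j

/-- Index sequence of a backward monomial with `p` initial factors. -/
def IsBackwardSeq (t p : ℕ) (g : ℕ → ℕ) : Prop :=
  (∀ i < p, g i = stair t i) ∧ ∀ i, g (p + i) = stair t p + 1 + i * t

lemma IsForwardSeq.add_le {t j i : ℕ} {g : ℕ → ℕ} (hg : IsForwardSeq t j g) (hi : i < j) :
    g i + t ≤ g (i + 1) := by
  have h := stair_succ t i
  have h1 := hg.1 i hi
  rcases (Nat.succ_le_of_lt hi).lt_or_eq with hlt | rfl
  · have := hg.1 _ hlt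
    simp only [Nat.succ_eq_add_one] at this
    omega
  · have := hg.2
    simp only [Nat.succ_eq_add_one] at this
    omega

lemma IsBackwardSeq.add_le {t p : ℕ} {g : ℕ → ℕ} (hg : IsBackwardSeq t p g) (i : ℕ) :
    g i + t ≤ g (i + 1) := by
  have h := stair_succ t i
  rcases lt_trichotomy (i + 1) p with hlt | heq | hgt
  · rw [hg.1 _ hlt, hg.1 i (by omega)]
    omega
  · have h1 := hg.2 0
    rw [add_zero, zero_mul, add_zero, ← heq] at h1
    rw [h1, hg.1 i (by omega)]
    omega
  · obtain ⟨e, rfl⟩ := Nat.exists_eq_add_of_le (show p ≤ i by omega)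
    rw [add_assoc, hg.2, hg.2, add_mul]
    omega

lemma forwardSet_enum {t j n : ℕ} {x : ℕ} :
    x ∈ forwardSet n t j ↔ ∃ i < j + 2,
      x = if i < j then stair t i else if i = j then (j + 1) + j * t else n := by
  simp only [forwardSet, Finset.mem_union, Finset.mem_image, Finset.mem_range, Finset.mem_insert,
    Finset.mem_singleton, stair]
  constructor
  · rintro (⟨i, hi, rfl⟩ | rfl | rfl)
    · exact ⟨i, by omega, by rw [if_pos hi]⟩
    · exact ⟨j, by omega, by simp⟩
    · exact ⟨j + 1, by omega, by simp⟩
  · rintro ⟨i, hi, rfl⟩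
    split_ifs with h1 h2
    · exact Or.inl ⟨i, h1, rfl⟩
    · exact Or.inr (Or.inl rfl)
    · exact Or.inr (Or.inr rfl)

lemma backwardSet_enum {t k d ν p c j : ℕ}
    (hp : jMax (d + k * t) t - 2 - sNum (d + k * t) t - ν * t = p)
    (hq : k - 4 - sNum (d + k * t) t - ν * (1 + t) = p + c) (hk : c + j + 1 = k) {x : ℕ} (hpj : p ≤ j) :
    x ∈ backwardSet t k d ν ↔ ∃ i < j + 2,
      x = if i < p then stair t i else d + (c + i) * t := by
  simp only [backwardSet, hp, hq, Finset.mem_union, Finset.mem_image, Finset.mem_range,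
    Finset.mem_Icc, stair]
  constructor
  · rintro (⟨i, hi, rfl⟩ | ⟨i, hi, rfl⟩)
    · exact ⟨i, by omega, by rw [if_pos hi]⟩
    · refine ⟨i - c, by omega, ?_⟩
      rw [if_neg (by omega), Nat.add_sub_cancel' (by omega)]
  · rintro ⟨i, hi, rfl⟩
    split_ifs with h1
    · exact Or.inl ⟨i, h1, rfl⟩
    · exact Or.inr ⟨c + i, by omega, rfl⟩

/-- Support of a basic monomial. -/
def basicSupport (t k d j : ℕ) : Finset (Fin (d + k * t)) :=
  Finset.univ.filter fun i => i.val + 1 ∈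
    if j ≤ jMax (d + k * t) t then forwardSet (d + k * t) t j
    else backwardSet t k d (j - jMax (d + k * t) t - 1)

lemma mem_basicSupport {t k d j : ℕ} {i : Fin (d + k * t)} :
    i ∈ basicSupport t k d j ↔ i.val + 1 ∈
      if j ≤ jMax (d + k * t) t then forwardSet (d + k * t) t j
      else backwardSet t k d (j - jMax (d + k * t) t - 1) := by
  simp only [basicSupport, Finset.mem_filter, Finset.mem_univ, true_and]

lemma basicMonomial_eq_ind (t k d j : ℕ) :
    basicMonomial t k d j = ind (basicSupport t k d j) := by
  ext i
  rw [ind_apply, basicMonomial]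
  by_cases h : j ≤ jMax (d + k * t) t <;> simp [h, mem_basicSupport, sqfree]

/-- Writing `n = (t+1)(J+1) + r` with `0 ≤ r ≤ t` gives `s = t - r`; in particular the truncated
subtractions defining `s` lose nothing. -/
lemma jMax_spec {t k d : ℕ} (hk : 3 ≤ k) (hd : 1 ≤ d) :
    d + k * t + sNum (d + k * t) t
        = jMax (d + k * t) t * t + jMax (d + k * t) t + 2 * t + 1 ∧ sNum (d + k * t) t ≤ t := by
  set N := d + k * t with hN
  have hkt : 3 * t ≤ k * t := Nat.mul_le_mul_right t hk
  have h1 := Nat.div_add_mod N (t + 1)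
  have h2 := Nat.mod_lt N (Nat.succ_pos t)
  have h3 : 1 ≤ N / (t + 1) := (Nat.one_le_div_iff (Nat.succ_pos t)).2 (by omega)
  have hJ : N / (t + 1) = jMax N t + 1 := by
    unfold jMax
    omega
  have hs : sNum N t = 2 * t - (N - ((jMax N t + 1) + jMax N t * t)) := rfl
  rw [hJ] at h1
  have h4 : (t + 1) * (jMax N t + 1) = jMax N t * t + jMax N t + t + 1 := by ring
  simp only [Nat.succ_eq_add_one] at h2
  omega

/-- With `c = k - j - 1`, both products of a backward monomial are governed by `p = c t + d - 3` and
`q = p + c`. The range of `j` forces `c ≥ 1` when `d ≤ 2`, which keeps `p` nonnegative. -/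
lemma backward_parameters {t k d j : ℕ} (ht : 2 ≤ t) (hk : 3 ≤ k) (hd : 1 ≤ d)
    (hj : jMax (d + k * t) t < j) (hjk : j + (if d ≤ 2 then 2 else 1) ≤ k) :
    ∃ c p, c + j + 1 = k ∧ p + 3 = c * t + d ∧ p + 2 ≤ jMax (d + k * t) t ∧
      jMax (d + k * t) t - 2 - sNum (d + k * t) t - (j - jMax (d + k * t) t - 1) * t = p ∧
      k - 4 - sNum (d + k * t) t - (j - jMax (d + k * t) t - 1) * (1 + t) = p + c := by
  obtain ⟨h1, h2⟩ := jMax_spec (t := t) hk hd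
  set J := jMax (d + k * t) t
  set s := sNum (d + k * t) t
  obtain ⟨ν, rfl⟩ := Nat.exists_eq_add_of_le (Nat.succ_le_of_lt hj)
  obtain ⟨c, hc⟩ := Nat.exists_eq_add_of_le (show J.succ + ν + 1 ≤ k by split_ifs at hjk <;> omega)
  simp only [Nat.succ_eq_add_one] at *
  have hν : J + 1 + ν - J - 1 = ν := by omega
  have e1 : k * t = J * t + 2 * t + ν * t + c * t := by
    rw [hc]
    ring
  have e2 : ν * (1 + t) = ν + ν * t := by ring
  have h3 : 3 ≤ c * t + d := by
    split_ifs at hjk with h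
    · have : 1 * t ≤ c * t := Nat.mul_le_mul_right t (by omega)
      omega
    · omega
  rw [hν, e2]
  refine ⟨c, c * t + d - 3, ?_, ?_, ?_, ?_, ?_⟩ <;> omega

theorem exists_basic_seq {t k d j : ℕ} (ht : 2 ≤ t) (hk : 3 ≤ k) (hd : 1 ≤ d)
    (hjk : j + (if d ≤ 2 then 2 else 1) ≤ k) :
    ∃ g, Enumerates g (j + 2) (basicSupport t k d j) ∧ g (j + 1) = d + k * t ∧
      (∀ i, i + 1 < j + 2 → g i + t ≤ g (i + 1)) ∧
      (j ≤ jMax (d + k * t) t ∧ IsForwardSeq t j g ∨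
        jMax (d + k * t) t < j ∧ ∃ c p, c + j + 1 = k ∧ p + 3 = c * t + d ∧
          p + 2 ≤ jMax (d + k * t) t ∧ IsBackwardSeq t p g) := by
  suffices H : ∃ g : ℕ → ℕ, (∀ x : Fin (d + k * t), x ∈ basicSupport t k d j ↔
        ∃ i < j + 2, x.val + 1 = g i) ∧ 1 ≤ g 0 ∧ g (j + 1) = d + k * t ∧
      (∀ i, i + 1 < j + 2 → g i + t ≤ g (i + 1)) ∧
      (j ≤ jMax (d + k * t) t ∧ IsForwardSeq t j g ∨
        jMax (d + k * t) t < j ∧ ∃ c p, c + j + 1 = k ∧ p + 3 = c * t + d ∧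
          p + 2 ≤ jMax (d + k * t) t ∧ IsBackwardSeq t p g) by
    obtain ⟨g, hmem, h0, hlast, hadd, hform⟩ := H
    have hlt : ∀ a e, a + (e + 1) < j + 2 → g a < g (a + (e + 1)) := by
      intro a e
      induction e with
      | zero =>
        intro he
        have := hadd a he
        rw [zero_add]
        omega
      | succ e ih =>
        intro he
        have h1 := ih (by omega)
        have h2 := hadd (a + (e + 1)) (by omega)
        rw [← add_assoc a (e + 1) 1]
        omega
    have hlt' : ∀ a b, a < b → b < j + 2 → g a < g b := by
      intro a b hab hb
      obtain ⟨e, rfl⟩ := Nat.exists_eq_add_of_lt hab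
      exact hlt a e hb
    refine ⟨g, ⟨hlt', fun i hi => ?_, fun i hi => ?_, hmem⟩, hlast, hadd, hform⟩
    · rcases Nat.eq_zero_or_pos i with rfl | hpos
      · exact h0
      · have := hlt' 0 i hpos hi
        omega
    · rcases (Nat.lt_succ_iff.1 hi).lt_or_eq with hlt | rfl
      · have := hlt' i (j + 1) hlt (by omega)
        omega
      · exact hlast.le
  rcases le_or_gt j (jMax (d + k * t) t) with hj | hj
  · let g : ℕ → ℕ := fun i => if i < j then stair t i else if i = j then (j + 1) + j * t
      else d + k * t
    have hg : IsForwardSeq t j g := by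
      refine ⟨fun i hi => by simp [g, hi], ?_⟩
      simp only [g, lt_irrefl, if_false, if_true, stair]
      omega
    have hgl : g (j + 1) = d + k * t := by simp [g]
    refine ⟨g, fun x => ?_, ?_, hgl, fun i hi => ?_, Or.inl ⟨hj, hg⟩⟩
    · rw [mem_basicSupport, if_pos hj, forwardSet_enum]
    · rcases Nat.eq_zero_or_pos j with rfl | hpos
      · simp [g]
      · simp [g, hpos, stair]
    · rcases (show i ≤ j by omega).lt_or_eq with hlt | rfl
      · exact hg.add_le hlt
      · obtain ⟨h1, h2⟩ := jMax_spec (t := t) hk hd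
        have h3 := hg.2
        have h4 : i * t ≤ jMax (d + k * t) t * t := Nat.mul_le_mul_right t hj
        rw [hgl]
        unfold stair at h3
        omega
  · obtain ⟨c, p, hc, hp, hpJ, hp', hq'⟩ := backward_parameters ht hk hd hj hjk
    let g : ℕ → ℕ := fun i => if i < p then stair t i else d + (c + i) * t
    have hg : IsBackwardSeq t p g := by
      refine ⟨fun i hi => by simp [g, hi], fun i => ?_⟩
      have e : (c + (p + i)) * t = c * t + p * t + i * t := by ring
      simp only [g]
      rw [if_neg (by omega), e]
      unfold stair
      omega
    refine ⟨g, fun x => ?_, ?_, ?_, fun i _ => hg.add_le i, Or.inr ⟨hj, c, p, hc, hp, hpJ, hg⟩⟩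
    · rw [mem_basicSupport, if_neg (by omega), backwardSet_enum hp' hq' hc (by omega)]
    · rcases Nat.eq_zero_or_pos p with rfl | hpos
      · have := hg.2 0
        unfold stair at this
        simp only [add_zero, zero_mul] at this
        omega
      · simp [g, hpos, stair]
    · simp only [g]
      rw [if_neg (by omega), ← hc]
      ring_nf

/-- No basic monomial lies below an earlier one. -/
theorem not_dom_basicSupport {t k d j j' : ℕ} (ht : 2 ≤ t) (hk : 3 ≤ k) (hd : 1 ≤ d)
    (hjk : j + (if d ≤ 2 then 2 else 1) ≤ k) (hj' : j' < j) :
    ¬ Dom (basicSupport t k d j) (basicSupport t k d j') := by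
  obtain ⟨g, hg, -, -, hform⟩ := exists_basic_seq ht hk hd hjk
  obtain ⟨g', hg', -, -, hform'⟩ := exists_basic_seq (j := j') ht hk hd (by omega)
  rw [hg.dom_iff hg']
  rintro ⟨-, hle⟩
  rcases hform with ⟨hj, hf⟩ | ⟨hj, c, p, hc, hp, hpJ, hb⟩
  · rcases hform' with ⟨-, hf'⟩ | ⟨h, -⟩
    · have h1 := hle j' (by omega)
      have h2 := hf'.2
      rw [hf.1 j' hj'] at h1
      omega
    · omega
  · have hbp := hb.2 0
    rw [add_zero, zero_mul, add_zero] at hbp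
    rcases hform' with ⟨hj2, hf'⟩ | ⟨hj2, c', p', hc', hp', hpJ', hb'⟩
    · have h2 := hf'.2
      rcases lt_trichotomy j' p with hlt | rfl | hgt
      · have h1 := hle j' (by omega)
        rw [hb.1 j' hlt] at h1
        omega
      · have h1 := hle j' (by omega)
        omega
      · have h1 := hle p (by omega)
        rw [hf'.1 p hgt] at h1
        omega
    · have h3 : (c + 1) * t ≤ c' * t := Nat.mul_le_mul_right t (by omega)
      rw [add_mul] at h3
      have h1 := hle p (by omega)
      rw [hb'.1 p (by omega)] at h1
      omega

/-- A spread monomial divisible by `x_n` and below a basic monomial, but below no earlier one, is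
that basic monomial. -/
theorem eq_basicSupport {t k d j : ℕ} (ht : 2 ≤ t) (hk : 3 ≤ k) (hd : 1 ≤ d)
    (hjk : j + (if d ≤ 2 then 2 else 1) ≤ k) {v : Finset (Fin (d + k * t))} {f : ℕ → ℕ}
    (hf : Enumerates f (j + 2) v) (hs : SpreadSet t v) (hlast : f (j + 1) = d + k * t)
    (hdom : Dom v (basicSupport t k d j))
    (hnot : ∀ j' < j, ¬ Dom v (basicSupport t k d j')) : v = basicSupport t k d j := by
  obtain ⟨g, hg, hgl, -, hform⟩ := exists_basic_seq ht hk hd hjk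
  have hle := ((hf.dom_iff hg).1 hdom).2
  -- As `v` avoids the cone under the forward `ω_j'`, staying on or under the stair before position
  -- `j'` forces it to reach the stair there. The last factor `x_n` of `ω_j'` imposes no condition.
  have hbarrier : ∀ j' < j, j' ≤ jMax (d + k * t) t → (∀ i < j', f i ≤ stair t i) →
      stair t j' ≤ f j' := by
    intro j' hj' hJ hi
    obtain ⟨g', hg', hgl', -, hform'⟩ := exists_basic_seq (j := j') ht hk hd (by omega)
    rcases hform' with ⟨-, h1, h2⟩ | ⟨h, -⟩
    · by_contra hlt
      refine hnot j' hj' ((hf.dom_iff hg').2 ⟨by omega, fun i hi' => ?_⟩)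
      rcases lt_trichotomy i j' with h | rfl | h
      · rw [h1 i h]
        exact hi i h
      · omega
      · obtain rfl : i = j' + 1 := by omega
        rw [hgl']
        exact hf.le _ (by omega)
    · omega
  refine hf.eq_of_forall_eq hg fun i hi => ?_
  rcases hform with ⟨hj, h1, h2⟩ | ⟨hj, c, p, hc, hp, hpJ, hb1, hb2⟩
  · have hlow : ∀ i < j, f i = stair t i := by
      intro i hi
      refine le_antisymm ((hle i (by omega)).trans_eq (h1 i hi)) (hbarrier i hi (by omega) ?_)
      intro i' hi'
      exact (hle i' (by omega)).trans_eq (h1 i' (by omega))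
    rcases lt_trichotomy i j with h | rfl | h
    · rw [hlow i h, h1 i h]
    · refine le_antisymm (hle i hi) ?_
      rcases Nat.eq_zero_or_pos i with rfl | hpos
      · have := hf.pos 0 (by omega)
        unfold stair at h2
        omega
      · obtain ⟨e, rfl⟩ := Nat.exists_eq_add_of_lt hpos
        rw [zero_add] at *
        -- The spread condition alone gives `f j ≥ stair t j - 1`, which is the forward value.
        have h3 := hf.add_le hs (i := e) (by omega)
        have h4 := stair_succ t e
        rw [hlow e (by omega)] at h3
        omega
    · obtain rfl : i = j + 1 := by omega
      rw [hlast, hgl]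
  · have hlow : ∀ i < p, f i = stair t i := by
      intro i hi
      refine le_antisymm ((hle i (by omega)).trans_eq (hb1 i hi))
        (hbarrier i (by omega) (by omega) ?_)
      intro i' hi'
      exact (hle i' (by omega)).trans_eq (hb1 i' (by omega))
    have hp0 := hbarrier p (by omega) (by omega) fun i hi => (hlow i hi).le
    have hgp := hb2 0
    rw [add_zero, zero_mul, add_zero] at hgp
    have hgp1 := hb2 1
    rw [one_mul] at hgp1
    have hgp2 := hb2 2
    have e1 := stair_succ t p
    have e2 := stair_succ t (p + 1)
    rw [show p + 1 + 1 = p + 2 from rfl] at e2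
    have l0 := hle p (by omega)
    have l1 := hle (p + 1) (by omega)
    have l2 := hle (p + 2) (by omega)
    -- If `f p` were `stair t p`, then positions up to `p + 1` would stay under the stair, and the
    -- barrier at `p + 2` would exceed the backward value `stair t p + 1 + 2 t` by one. Once `f p`
    -- is fixed, spreadness forces the rest.
    have hfp : f p = stair t p + 1 := by
      by_contra hne
      have hbar2 := hbarrier (p + 2) (by omega) (by omega) (by
        intro i hi
        rcases lt_trichotomy i p with h | rfl | h
        · exact (hlow i h).le
        · omega
        · obtain rfl : i = p + 1 := by omega
          omega)
      omega
    rcases lt_or_ge i p with h | h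
    · rw [hlow i h, hb1 i h]
    · refine le_antisymm (hle i hi) ?_
      obtain ⟨e, rfl⟩ := Nat.exists_eq_add_of_le h
      have := hf.add_mul_le hs (i := p) e hi
      rw [hb2, mul_comm e t]
      omega

/-! ### The ideal generated by the basic monomials -/

section BasicIdeal

variable {t k d : ℕ}

/-- Supports of the basic monomials. -/
def basicSupports (t k d : ℕ) : Set (Finset (Fin (d + k * t))) :=
  {w | ∃ j, j + (if d ≤ 2 then 2 else 1) ≤ k ∧ w = basicSupport t k d j}

lemma le_floor_iff (ht : 2 ≤ t) (hd : 1 ≤ d) (hdt : d ≤ t) (j : ℕ) :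
    (j : ℤ) ≤ k + ⌊((d : ℚ) - 3) / t⌋ - 1 ↔ j + (if d ≤ 2 then 2 else 1) ≤ k := by
  split_ifs with h
  · rw [floor_eq_of_le_two ht hd h]
    omega
  · rw [floor_eq_of_three_le (by omega) hdt]
    omega

lemma spreadSet_basicSupport (ht : 2 ≤ t) (hk : 3 ≤ k) (hd : 1 ≤ d) {j : ℕ}
    (hj : j + (if d ≤ 2 then 2 else 1) ≤ k) : SpreadSet t (basicSupport t k d j) := by
  obtain ⟨g, hg, -, hadd, -⟩ := exists_basic_seq ht hk hd hj
  exact hg.spreadSet hadd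

lemma card_basicSupport (ht : 2 ≤ t) (hk : 3 ≤ k) (hd : 1 ≤ d) {j : ℕ}
    (hj : j + (if d ≤ 2 then 2 else 1) ≤ k) : (basicSupport t k d j).card = j + 2 := by
  obtain ⟨g, hg, -⟩ := exists_basic_seq ht hk hd hj
  exact hg.card_eq

lemma basicIdeal_eq (ht : 2 ≤ t) (hk : 3 ≤ k) (hd : 1 ≤ d) (hdt : d ≤ t) :
    basicIdeal K t k d = dominatedIdeal K t (basicSupports t k d) := by
  rw [← borelIdeal_eq_dominatedIdeal (by omega)]
  · unfold basicIdeal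
    congr 1
    ext u
    simp only [Set.mem_ofPred_eq, Set.mem_image, basicSupports, le_floor_iff ht hd hdt,
      basicMonomial_eq_ind]
    constructor
    · rintro ⟨j, hj, rfl⟩
      exact ⟨_, ⟨j, hj, rfl⟩, rfl⟩
    · rintro ⟨_, ⟨j, hj, rfl⟩, rfl⟩
      exact ⟨j, hj, rfl⟩
  · rintro _ ⟨j, hj, rfl⟩
    exact spreadSet_basicSupport ht hk hd hj

lemma isStronglyStable_basicIdeal (ht : 2 ≤ t) (hk : 3 ≤ k) (hd : 1 ≤ d) (hdt : d ≤ t) :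
    IsStronglyStable t (basicIdeal K t k d) := by
  rw [basicIdeal_eq ht hk hd hdt]
  exact isStronglyStable_dominatedIdeal (by omega) _

lemma exists_dom_of_hasMonomial_basicIdeal (ht : 2 ≤ t) (hk : 3 ≤ k) (hd : 1 ≤ d) (hdt : d ≤ t)
    {v : Finset (Fin (d + k * t))} (hv : HasMonomial (basicIdeal K t k d) v) :
    ∃ j, j + (if d ≤ 2 then 2 else 1) ≤ k ∧ Dom v (basicSupport t k d j) := by
  rw [basicIdeal_eq ht hk hd hdt] at hv
  obtain ⟨_, ⟨j, hj, rfl⟩, h⟩ := hv.exists_dom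
  exact ⟨j, hj, h⟩

lemma hasMonomial_basicSupport (ht : 2 ≤ t) (hk : 3 ≤ k) (hd : 1 ≤ d) (hdt : d ≤ t) {j : ℕ}
    (hj : j + (if d ≤ 2 then 2 else 1) ≤ k) :
    HasMonomial (basicIdeal K t k d) (basicSupport t k d j) := by
  rw [basicIdeal_eq ht hk hd hdt]
  exact (spreadSet_basicSupport ht hk hd hj).hasMonomial_dominatedIdeal ⟨j, hj, rfl⟩ (Dom.refl _)

/-- A proper divisor in the ideal is too short to lie below anything but an earlier basic monomial,
and then `ω_j` would lie below that one too. -/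
lemma basicSupport_mem_minGens (ht : 2 ≤ t) (hk : 3 ≤ k) (hd : 1 ≤ d) (hdt : d ≤ t) {j : ℕ}
    (hj : j + (if d ≤ 2 then 2 else 1) ≤ k) :
    basicSupport t k d j ∈ minGens t (basicIdeal K t k d) := by
  refine mem_minGens.2 ⟨spreadSet_basicSupport ht hk hd hj,
    hasMonomial_basicSupport ht hk hd hdt hj, fun v hv hm => ?_⟩
  obtain ⟨j', hj', hd'⟩ := exists_dom_of_hasMonomial_basicIdeal ht hk hd hdt hm
  have h1 := hd'.card_le
  have h2 := Finset.card_lt_card hv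
  rw [card_basicSupport ht hk hd hj'] at h1
  rw [card_basicSupport ht hk hd hj] at h2
  exact not_dom_basicSupport ht hk hd hj (by omega) ((Dom.of_subset hv.subset).trans hd')

lemma exists_of_mem_minGens_basicIdeal (ht : 2 ≤ t) (hk : 3 ≤ k) (hd : 1 ≤ d) (hdt : d ≤ t)
    {v : Finset (Fin (d + k * t))} (hv : v ∈ minGens t (basicIdeal K t k d)) :
    ∃ j, j + (if d ≤ 2 then 2 else 1) ≤ k ∧ v.card = j + 2 ∧ Dom v (basicSupport t k d j) := by
  obtain ⟨j, hj, hd'⟩ := exists_dom_of_hasMonomial_basicIdeal ht hk hd hdt (mem_minGens.1 hv).2.1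
  have hc := hd'.card_le
  refine ⟨j, hj, ?_, hd'⟩
  rw [card_basicSupport ht hk hd hj] at hc
  by_contra hne
  exact (isStronglyStable_basicIdeal ht hk hd hdt).not_dom_of_card_lt hv
    (spreadSet_basicSupport ht hk hd hj) (hasMonomial_basicSupport ht hk hd hdt hj)
    (by rw [card_basicSupport ht hk hd hj]; omega) hd'

lemma card_gapSet_basicSupport (ht : 2 ≤ t) (hk : 3 ≤ k) (hd : 1 ≤ d) {j : ℕ}
    (hj : j + (if d ≤ 2 then 2 else 1) ≤ k) :
    (gapSet t (basicSupport t k d j)).card + t * (j + 1) + 1 = d + k * t := by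
  obtain ⟨g, hg, hgl, -⟩ := exists_basic_seq ht hk hd hj
  have := hg.card_gapSet_add (spreadSet_basicSupport ht hk hd hj) (by omega)
  rwa [show j + 2 - 1 = j + 1 from rfl, hgl] at this

/-- The maximum for a given degree is reached when `x_n` occurs, as it does in every basic monomial.
-/
lemma card_gapSet_le {v : Finset (Fin n)} (hv : SpreadSet t v) {j : ℕ} (hc : v.card = j + 2) :
    (gapSet t v).card + t * (j + 1) + 1 ≤ n := by
  obtain ⟨f, hf⟩ := exists_enumerates v
  rw [hc] at hf
  have := hf.card_gapSet_add hv (by omega)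
  rw [show j + 2 - 1 = j + 1 from rfl] at this
  exact this.trans_le (hf.le _ (by omega))

lemma eq_basicSupport_of_mem_minGens (ht : 2 ≤ t) (hk : 3 ≤ k) (hd : 1 ≤ d) (hdt : d ≤ t)
    {v : Finset (Fin (d + k * t))} (hv : v ∈ minGens t (basicIdeal K t k d)) {j : ℕ}
    (hc : v.card = j + 2) (hgap : (gapSet t v).card + t * (j + 1) + 1 = d + k * t) :
    v = basicSupport t k d j := by
  obtain ⟨i, hi, hci, hdom⟩ := exists_of_mem_minGens_basicIdeal ht hk hd hdt hv
  obtain rfl : i = j := by omega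
  have hv' := mem_minGens.1 hv
  obtain ⟨f, hf⟩ := exists_enumerates v
  rw [hc] at hf
  have := hf.card_gapSet_add hv'.1 (by omega)
  rw [show i + 2 - 1 = i + 1 from rfl, hgap] at this
  refine eq_basicSupport ht hk hd hi hf hv'.1 this.symm hdom fun j' hj' => ?_
  have hj'' : j' + (if d ≤ 2 then 2 else 1) ≤ k := by omega
  exact (isStronglyStable_basicIdeal ht hk hd hdt).not_dom_of_card_lt hv
    (spreadSet_basicSupport ht hk hd hj'') (hasMonomial_basicSupport ht hk hd hdt hj'')
    (by rw [card_basicSupport ht hk hd hj'']; omega)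

/-- Each `ω_j` attains the maximal gap count of its degree, and this maximum drops by `t` with each
degree, so no higher degree interferes. -/
theorem isCorner_basicIdeal_iff (ht : 2 ≤ t) (hk : 3 ≤ k) (hd : 1 ≤ d) (hdt : d ≤ t) {a l : ℕ} :
    IsCorner (basicIdeal K t k d) a l ↔ ∃ j, j + (if d ≤ 2 then 2 else 1) ≤ k ∧ l = j + 2 ∧
      a = (gapSet t (basicSupport t k d j)).card := by
  rw [(isStronglyStable_basicIdeal ht hk hd hdt).isCorner_iff (by omega)]
  constructor
  · rintro ⟨⟨u, hu, hul, hua⟩, h⟩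
    obtain ⟨j, hj, huj, -⟩ := exists_of_mem_minGens_basicIdeal ht hk hd hdt hu
    refine ⟨j, hj, by omega, ?_⟩
    have h1 := (h _ (basicSupport_mem_minGens ht hk hd hdt hj)).1
      (by rw [card_basicSupport ht hk hd hj]; omega)
    have h2 := card_gapSet_basicSupport ht hk hd hj
    have h3 := card_gapSet_le (mem_minGens.1 hu).1 huj
    omega
  · rintro ⟨j, hj, rfl, rfl⟩
    refine ⟨⟨_, basicSupport_mem_minGens ht hk hd hdt hj, card_basicSupport ht hk hd hj, rfl⟩,
      fun v hv => ⟨fun hc => ?_, fun hc => ?_⟩⟩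
    · have h2 := card_gapSet_basicSupport ht hk hd hj
      have h3 := card_gapSet_le (mem_minGens.1 hv).1 hc
      omega
    · obtain ⟨i, -, hvi, -⟩ := exists_of_mem_minGens_basicIdeal ht hk hd hdt hv
      have h2 := card_gapSet_basicSupport ht hk hd hj
      have h3 := card_gapSet_le (mem_minGens.1 hv).1 hvi
      have h4 : t * (j + 1 + 1) ≤ t * (i + 1) := Nat.mul_le_mul_left t (by omega)
      rw [mul_add t (j + 1) 1] at h4
      omega

theorem isStronglyStableOne_basicIdeal (ht : 2 ≤ t) (hk : 3 ≤ k) (hd : 1 ≤ d) (hdt : d ≤ t) :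
    IsStronglyStableOne t (basicIdeal K t k d) := by
  have hI := isStronglyStable_basicIdeal (K := K) ht hk hd hdt
  refine ⟨hI, fun a l hc => ?_⟩
  rw [hI.betti_eq_of_isCorner (by omega) hc, Finset.card_eq_one]
  obtain ⟨j, hj, rfl, rfl⟩ := (isCorner_basicIdeal_iff ht hk hd hdt).1 hc
  refine ⟨basicSupport t k d j, ?_⟩
  ext v
  rw [Finset.mem_filter, Finset.mem_singleton]
  constructor
  · rintro ⟨hv, hvc, hvg⟩
    refine eq_basicSupport_of_mem_minGens ht hk hd hdt hv hvc ?_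
    rw [hvg]
    exact card_gapSet_basicSupport ht hk hd hj
  · rintro rfl
    exact ⟨basicSupport_mem_minGens ht hk hd hdt hj, card_basicSupport ht hk hd hj, rfl⟩

lemma hasInitialDegree_basicIdeal (ht : 2 ≤ t) (hk : 3 ≤ k) (hd : 1 ≤ d) (hdt : d ≤ t) :
    HasInitialDegree (basicIdeal K t k d) 2 := by
  have h0 : 0 + (if d ≤ 2 then 2 else 1) ≤ k := by split_ifs <;> omega
  refine ⟨⟨_, hasMonomial_basicSupport ht hk hd hdt h0, by simp, ?_⟩, ?_⟩
  · refine isHomogeneous_monomial _ ?_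
    rw [degree_ind, card_basicSupport ht hk hd h0]
  · rintro q ⟨f, hf, hf0, hq⟩
    obtain ⟨m, hm⟩ := ne_zero_iff.1 hf0
    rw [(isStronglyStable_basicIdeal ht hk hd hdt).1.eq_monomialIdeal (by omega),
      mem_monomialIdeal] at hf
    obtain ⟨_, ⟨v, hv, rfl⟩, hle⟩ := hf m hm
    obtain ⟨j, -, hc, -⟩ := exists_of_mem_minGens_basicIdeal ht hk hd hdt hv
    have h1 := Finsupp.degree_mono hle
    rw [degree_ind, hc] at h1
    have h2 : m.degree = q := by
      by_contra hne
      exact hm (hq.coeff_eq_zero hne)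
    omega

theorem finite_corners_and_ncard_eq (ht : 2 ≤ t) (hk : 3 ≤ k) (hd : 1 ≤ d) (hdt : d ≤ t) :
    (corners (basicIdeal K t k d)).Finite ∧
      (corners (basicIdeal K t k d)).ncard = if d ≤ 2 then k - 1 else k := by
  classical
  let F : ℕ → ℕ × ℕ := fun j => ((gapSet t (basicSupport t k d j)).card, j + 2)
  have hF : Function.Injective F := by
    intro i j hij
    have := congrArg Prod.snd hij
    simpa [F] using this
  have hC : corners (basicIdeal K t k d)
      = ((Finset.range (if d ≤ 2 then k - 1 else k)).image F : Set (ℕ × ℕ)) := by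
    ext ⟨a, l⟩
    change IsCorner _ a l ↔ _
    rw [isCorner_basicIdeal_iff ht hk hd hdt, Finset.mem_coe, Finset.mem_image]
    refine exists_congr fun j => ?_
    rw [Finset.mem_range]
    have hr : j + (if d ≤ 2 then 2 else 1) ≤ k ↔ j < if d ≤ 2 then k - 1 else k := by
      split_ifs <;> omega
    rw [hr]
    simp only [F, Prod.mk.injEq]
    exact and_congr_right fun _ => ⟨fun h => ⟨h.2.symm, h.1.symm⟩, fun h => ⟨h.2.symm, h.1.symm⟩⟩
  rw [hC]
  refine ⟨Finset.finite_toSet _, ?_⟩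
  rw [Set.ncard_coe_finset, Finset.card_image_of_injective _ hF, Finset.card_range]

end BasicIdeal

/-! ### Assembly of the theorem. -/

lemma bound_eq_floor {t k d : ℕ} (ht : 2 ≤ t) (hk : 3 ≤ k) (hd : 1 ≤ d) (hdt : d ≤ t) :
    (((if d ≤ 2 then k - 1 else k : ℕ)) : ℤ) = k + ⌊((d : ℚ) - 3) / t⌋ := by
  split_ifs with h
  · rw [floor_eq_of_le_two ht hd h]
    omega
  · rw [floor_eq_of_three_le (by omega) hdt]
    omega

end TSpread

end

theorem mainTheorem1 (K : Type*) [Field K] (t k d : ℕ) (ht : 2 ≤ t) (hk : 3 ≤ k)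
    (hd : 1 ≤ d) (hdt : d ≤ t) :
    (∀ I : Ideal (MvPolynomial (Fin (d + k * t)) K),
      TSpread.IsStronglyStableOne t I → TSpread.HasInitialDegree I 2 →
      (∃ a : ℕ, TSpread.IsCorner I a 2) →
        (TSpread.corners I).Finite ∧
          ((TSpread.corners I).ncard : ℤ) ≤ k + ⌊((d : ℚ) - 3) / t⌋) ∧
    (TSpread.IsStronglyStableOne t (TSpread.basicIdeal K t k d) ∧
      TSpread.HasInitialDegree (TSpread.basicIdeal K t k d) 2 ∧
      (∃ a : ℕ, TSpread.IsCorner (TSpread.basicIdeal K t k d) a 2) ∧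
      (TSpread.corners (TSpread.basicIdeal K t k d)).Finite ∧
      ((TSpread.corners (TSpread.basicIdeal K t k d)).ncard : ℤ) = k + ⌊((d : ℚ) - 3) / t⌋) ∧
    (d = 1 ∨ d = 2 → (k : ℤ) + ⌊((d : ℚ) - 3) / t⌋ = k - 1) ∧
    (3 ≤ d → (k : ℤ) + ⌊((d : ℚ) - 3) / t⌋ = k) := by
  refine ⟨fun I hI hin ⟨a, ha⟩ => ?_, ⟨TSpread.isStronglyStableOne_basicIdeal ht hk hd hdt,
    TSpread.hasInitialDegree_basicIdeal ht hk hd hdt, ?_, ?_, ?_⟩, fun h => ?_, fun h => ?_⟩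
  · obtain ⟨hfin, hle⟩ := hI.1.finite_corners_and_ncard_le (by omega) hk hdt hin ha
    refine ⟨hfin, ?_⟩
    rw [← TSpread.bound_eq_floor ht hk hd hdt]
    exact_mod_cast hle
  · exact ⟨_, (TSpread.isCorner_basicIdeal_iff ht hk hd hdt).2
      ⟨0, by split_ifs <;> omega, rfl, rfl⟩⟩
  · exact (TSpread.finite_corners_and_ncard_eq ht hk hd hdt).1
  · rw [(TSpread.finite_corners_and_ncard_eq ht hk hd hdt).2, TSpread.bound_eq_floor ht hk hd hdt]
  · rw [TSpread.floor_eq_of_le_two ht hd (by omega)]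
    ring
  · rw [TSpread.floor_eq_of_three_le h hdt, add_zero]
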